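/- **Setting.** Let $\mathcal L_{\mathsf{Uni},\mathsf{Mod}}$ be the first-order language with equality and the non-logical symbols $\in$, $\mathsf{Uni}$ (unary) and $\mathsf{Mod}$ (ternary), with primitive connectives $\neg,\wedge,\forall$ and variables $x_0,x_1,\dots$; $\mathsf{Uni}(\mathcal U)$ is read "$\mathcal U$ is a universe" and $\mathsf{Mod}(\mathcal U,\varphi,f)$ is read "the formula (coded by) $\varphi$ holds in $\mathcal U$ under the variable assignment $f$". Natural numbers, finite sequences and Gödel codes of formulas are treated as defined notions of set theory; $\ulcorner\varphi\urcorner$ is the (hereditarily finite, definable) code of $\varphi$, and $\dot\neg,\dot\wedge,\dot\forall$ are the definable operations on codes that correspond to $\neg,\wedge,\forall$. Let $\mathrm{Var}$ be the set of (codes of) variables; let $\mathrm{VA}^{\mathcal U}$ be the set of all functions $f:\mathrm{Var}\to\mathcal U$, and for $f\in \mathrm{VA}^{\mathcal U}$ and $u\in\mathrm{Var}$ let $\mathrm{VA}^{\mathcal U}_{f,u}$ be the set of those $g\in\mathrm{VA}^{\mathcal U}$ that agree with $f$ off $u$. Put $$\mathsf{Tr}^{\Box}(x)\;:\equiv\;\forall\,\mathcal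 U\,\bigl(\mathsf{Uni}(\mathcal U)\to\forall f\in\mathrm{VA}^{\mathcal U}\;\mathsf{Mod}(\mathcal U,x,f)\bigr).$$ The theory $\mathsf{CM}^-$ consists of $\mathsf{ZF}$, with Separation and Replacement for all $\mathcal L_{\mathsf{Uni},\mathsf{Mod}}$-formulas, and the following axioms, for all $\mathcal U$ with $\mathsf{Uni}(\mathcal U)$, all $f\in\mathrm{VA}^{\mathcal U}$, all $u,v\in\mathrm{Var}$, and all (codes of) $\mathcal L_{\mathsf{Uni},\mathsf{Mod}}$-formulas $\varphi,\psi$: * $\mathsf{Mod}(\mathcal U,\ulcorner u=v\urcorner,f)\leftrightarrow f(u)=f(v)$; * $\mathsf{Mod}(\mathcal U,\dot\neg\varphi,f)\leftrightarrow\neg\,\mathsf{Mod}(\mathcal U,\varphi,f)$; * $\mathsf{Mod}(\mathcal U,\varphi\,\dot\wedge\,\psi,f)\leftrightarrow\mathsf{Mod}(\mathcal U,\varphi,f)\wedge\mathsf{Mod}(\mathcal U,\psi,f)$; * $\mathsf{Mod}(\mathcal U,\dot\forall u\,\varphi,f)\leftrightarrow\forall g\in\mathrm{VA}^{\mathcal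 U}_{f,u}\;\mathsf{Mod}(\mathcal U,\varphi,g)$. $\mathsf{NEC}$ is the rule: from a proof of a sentence $\sigma$ infer $\mathsf{Tr}^{\Box}(\ulcorner\sigma\urcorner)$. In a system with $\mathsf{NEC}$ the rule may be applied to every sentence proved in the system, whichever axioms its proof uses. $\textsf{Non-Triviality}$ is the sentence $\exists\,\mathcal U\;\mathsf{Uni}(\mathcal U)$. **Theorem.** (a) The system $\mathsf{CM}^-+\mathsf{NEC}$ together with the schema $$\mathsf T_{\mathsf{CM}}:\qquad \mathsf{Tr}^{\Box}(\ulcorner\sigma\urcorner)\to\sigma\qquad(\sigma\text{ an }\mathcal L_{\mathsf{Uni},\mathsf{Mod}}\text{-sentence})$$ is inconsistent. (b) The system $\mathsf{CM}^-+\mathsf{NEC}+\textsf{Non-Triviality}$ together with the schema $$\mathsf 4_{\mathsf{CM}}:\qquad \mathsf{Tr}^{\Box}(\ulcorner\sigma\urcorner)\to\mathsf{Tr}^{\Box}\bigl(\ulcorner\mathsf{Tr}^{\Box}(\ulcorner\sigma\urcorner)\urcorner\bigr)\qquad(\sigma\text{ an }\mathcal L_{\mathsf{Uni},\mathsf{Mod}}\text{-sentence})$$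 is inconsistent. Here universes are, as domains of first-order structures, nonempty; that is, the axiom $\forall\,\mathcal U\,(\mathsf{Uni}(\mathcal U)\to\exists x\;x\in\mathcal U)$ is included in (b). -/

import Mathlib

namespace Multiverse

/-! ### Syntax of the language with the symbols `∈`, `Uni`, `Mod` -/

/-- Formulas over the non-logical symbols `∈`, `Uni` (unary) and `Mod` (ternary), with equality,
primitive connectives `¬`, `∧`, `∀`, and variables `x₀, x₁, …` given by their indices. -/
inductive Fml : Type
  | eq (i j : ℕ) : Fml
  | mem (i j : ℕ) : Fml
  | uni (i : ℕ) : Fml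
  | mod (i j k : ℕ) : Fml
  | neg (φ : Fml) : Fml
  | and (φ ψ : Fml) : Fml
  | all (i : ℕ) (φ : Fml) : Fml

namespace Fml

/-- Material implication, `¬(φ ∧ ¬ψ)`. -/
def imp (φ ψ : Fml) : Fml := neg (and φ (neg ψ))

/-- Disjunction. -/
def or (φ ψ : Fml) : Fml := neg (and (neg φ) (neg ψ))

/-- Biconditional. -/
def iff (φ ψ : Fml) : Fml := and (imp φ ψ) (imp ψ φ)

/-- Existential quantification. -/
def ex (i : ℕ) (φ : Fml) : Fml := neg (all i (neg φ))

/-- The finite set of variables that occur free in a formula. -/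
def fv : Fml → Finset ℕ
  | eq i j => {i, j}
  | mem i j => {i, j}
  | uni i => {i}
  | mod i j k => {i, j, k}
  | neg φ => fv φ
  | and φ ψ => fv φ ∪ fv ψ
  | all i φ => (fv φ).erase i

/-- A sentence is a formula without free variables. -/
def IsSentence (φ : Fml) : Prop := fv φ = ∅

/-- Simultaneous capture-avoiding substitution of variables for free variables.  A bound variable
is renamed to one that differs from all variables put in for the free variables of the quantified
formula. -/
def subst : (ℕ → ℕ) → Fml → Fml
  | ρ, eq i j => eq (ρ i) (ρ j)
  | ρ, mem i j => mem (ρ i) (ρ j)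
  | ρ, uni i => uni (ρ i)
  | ρ, mod i j k => mod (ρ i) (ρ j) (ρ k)
  | ρ, neg φ => neg (subst ρ φ)
  | ρ, and φ ψ => and (subst ρ φ) (subst ρ ψ)
  | ρ, all i φ =>
      let z := (((fv φ).erase i).image ρ).sup id + 1
      all z (subst (Function.update ρ i z) φ)

/-- `φ[y/x]`: the variable `y` for the free occurrences of the variable `x`. -/
def subst1 (φ : Fml) (x y : ℕ) : Fml := subst (Function.update id x y) φ

/-- Propositional tautologies: true under every assignment of truth values to formulas that
respects `¬` and `∧`. -/
def IsTautology (φ : Fml) : Prop :=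
  ∀ V : Fml → Prop, (∀ ψ, V (neg ψ) ↔ ¬ V ψ) → (∀ ψ χ, V (and ψ χ) ↔ (V ψ ∧ V χ)) → V φ

end Fml

infix:70 " =ₒ " => Fml.eq
infix:70 " ∈ₒ " => Fml.mem
prefix:65 "¬ₒ " => Fml.neg
infixr:60 " ∧ₒ " => Fml.and
infixr:58 " ∨ₒ " => Fml.or
infixr:55 " →ₒ " => Fml.imp
infix:54 " ↔ₒ " => Fml.iff
notation "∀ₒ " => Fml.all
notation "∃ₒ " => Fml.ex

/-! ### Set-theoretic formulas

The arguments are (indices of) variables.  Bound variables have indices larger than those of all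
arguments. -/

/-- `x = ∅`. -/
def isEmpty (x : ℕ) : Fml := ∀ₒ (x + 1) (¬ₒ (x + 1) ∈ₒ x)

/-- `y = x ∪ {x}`. -/
def isSucc (y x : ℕ) : Fml :=
  let z := y + x + 1
  ∀ₒ z (z ∈ₒ y ↔ₒ (z ∈ₒ x ∨ₒ z =ₒ x))

/-- `p = {x, y}`. -/
def isUPair (p x y : ℕ) : Fml :=
  let z := p + x + y + 1
  ∀ₒ z (z ∈ₒ p ↔ₒ (z =ₒ x ∨ₒ z =ₒ y))

/-- `p = ⟨x, y⟩ = {{x}, {x, y}}`. -/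
def isPair (p x y : ℕ) : Fml :=
  let z := p + x + y + 1
  ∀ₒ z (z ∈ₒ p ↔ₒ (isUPair z x x ∨ₒ isUPair z x y))

/-- `X` contains `∅` and is closed under `y ↦ y ∪ {y}`. -/
def isInductive (X : ℕ) : Fml :=
  let y := X + 1
  let z := X + 2
  (∀ₒ y (isEmpty y →ₒ y ∈ₒ X)) ∧ₒ ∀ₒ y (y ∈ₒ X →ₒ ∀ₒ z (isSucc z y →ₒ z ∈ₒ X))

/-- `n` is a natural number (an element of every inductive set).  Object-level variables are coded
by their indices, so this is also the formula `n ∈ Var`. -/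
def isNat (n : ℕ) : Fml :=
  let X := n + 1
  ∀ₒ X (isInductive X →ₒ n ∈ₒ X)

/-- The formula that defines the von Neumann numeral `n`. -/
def isNum : ℕ → ℕ → Fml
  | 0, v => isEmpty v
  | n + 1, v => ∃ₒ (v + 1) (isNum n (v + 1) ∧ₒ isSucc v (v + 1))

/-! ### Gödel coding

Formulas are coded by hereditarily finite sets built from numerals by ordered pairs. -/

/-- Expressions for hereditarily finite sets built from numerals by pairing. -/
inductive Code : Type
  | num (n : ℕ) : Code
  | pair (a b : Code) : Code

/-- The Gödel code of a formula; variables are coded by their indices. -/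
def Fml.code : Fml → Code
  | .eq i j => .pair (.num 0) (.pair (.num i) (.num j))
  | .mem i j => .pair (.num 1) (.pair (.num i) (.num j))
  | .uni i => .pair (.num 2) (.num i)
  | .mod i j k => .pair (.num 3) (.pair (.num i) (.pair (.num j) (.num k)))
  | .neg φ => .pair (.num 4) φ.code
  | .and φ ψ => .pair (.num 5) (.pair φ.code ψ.code)
  | .all i φ => .pair (.num 6) (.pair (.num i) φ.code)

/-- The formula that defines the set denoted by a code. -/
def isCode : Code → ℕ → Fml
  | .num n, v => isNum n v
  | .pair a b, v =>
      ∃ₒ (v + 1) (∃ₒ (v + 2) (isCode a (v + 1) ∧ₒ isCode b (v + 2) ∧ₒ isPair v (v + 1) (v + 2)))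

/-- `c = ⟨k, a⟩` for the numeral `k`. -/
def isTagged (k c a : ℕ) : Fml :=
  let t := c + a + 1
  ∃ₒ t (isNum k t ∧ₒ isPair c t a)

/-- `c = ⟨k, ⟨a, b⟩⟩` for the numeral `k`. -/
def isTagged2 (k c a b : ℕ) : Fml :=
  let p := c + a + b + 1
  ∃ₒ p (isPair p a b ∧ₒ isTagged k c p)

/-- `c` is the code of the formula `xᵢ = xⱼ`. -/
def isEqCode (c i j : ℕ) : Fml := isTagged2 0 c i j

/-- `c` is the code of the formula `xᵢ ∈ xⱼ`. -/
def isMemCode (c i j : ℕ) : Fml := isTagged2 1 c i j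

/-- `c` is the code of the formula `Uni(xᵢ)`. -/
def isUniCode (c i : ℕ) : Fml := isTagged 2 c i

/-- `c` is the code of the formula `Mod(xᵢ, xⱼ, xₖ)`. -/
def isModCode (c i j k : ℕ) : Fml :=
  let p := c + i + j + k + 1
  ∃ₒ p (isPair p j k ∧ₒ isTagged2 3 c i p)

/-- `c` is the code of the negation of the formula coded by `a`. -/
def isNegCode (c a : ℕ) : Fml := isTagged 4 c a

/-- `c` is the code of the conjunction of the formulas coded by `a` and `b`. -/
def isAndCode (c a b : ℕ) : Fml := isTagged2 5 c a b

/-- `c` is the code of the universal quantification over the variable `u` of the formula coded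
by `a`. -/
def isAllCode (c u a : ℕ) : Fml := isTagged2 6 c u a

/-- The set `X` contains the codes of all atomic formulas and is closed under the (coded)
operations `¬`, `∧` and `∀`. -/
def isFormClosed (X : ℕ) : Fml :=
  let c := X + 1
  let i := X + 2
  let j := X + 3
  let k := X + 4
  (∀ₒ i (∀ₒ j (∀ₒ c (isNat i ∧ₒ isNat j ∧ₒ isEqCode c i j →ₒ c ∈ₒ X)))) ∧ₒ
  (∀ₒ i (∀ₒ j (∀ₒ c (isNat i ∧ₒ isNat j ∧ₒ isMemCode c i j →ₒ c ∈ₒ X)))) ∧ₒ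
  (∀ₒ i (∀ₒ c (isNat i ∧ₒ isUniCode c i →ₒ c ∈ₒ X))) ∧ₒ
  (∀ₒ i (∀ₒ j (∀ₒ k (∀ₒ c
    (isNat i ∧ₒ isNat j ∧ₒ isNat k ∧ₒ isModCode c i j k →ₒ c ∈ₒ X))))) ∧ₒ
  (∀ₒ i (∀ₒ c (i ∈ₒ X ∧ₒ isNegCode c i →ₒ c ∈ₒ X))) ∧ₒ
  (∀ₒ i (∀ₒ j (∀ₒ c (i ∈ₒ X ∧ₒ j ∈ₒ X ∧ₒ isAndCode c i j →ₒ c ∈ₒ X)))) ∧ₒ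
  (∀ₒ i (∀ₒ j (∀ₒ c (isNat i ∧ₒ j ∈ₒ X ∧ₒ isAllCode c i j →ₒ c ∈ₒ X))))

/-- `c` is the code of a formula: it lies in the least class that contains the codes of all atomic
formulas and is closed under the connectives and quantifiers. -/
def isForm (c : ℕ) : Fml :=
  let X := c + 1
  ∀ₒ X (isFormClosed X →ₒ c ∈ₒ X)

/-! ### Variable assignments and truth in all universes -/

/-- `⟨i, a⟩ ∈ f`, that is, `f(i) = a` for a function `f`. -/
def isVal (f i a : ℕ) : Fml :=
  let p := f + i + a + 1
  ∃ₒ p (p ∈ₒ f ∧ₒ isPair p i a)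

/-- `f` is a variable assignment into `U`, that is, a function from `Var` to `U`. -/
def isAssign (f U : ℕ) : Fml :=
  let p := f + U + 1
  let i := f + U + 2
  let a := f + U + 3
  let b := f + U + 4
  (∀ₒ p (p ∈ₒ f →ₒ ∃ₒ i (∃ₒ a (isNat i ∧ₒ a ∈ₒ U ∧ₒ isPair p i a)))) ∧ₒ
  (∀ₒ i (isNat i →ₒ ∃ₒ a (isVal f i a ∧ₒ ∀ₒ b (isVal f i b →ₒ b =ₒ a))))

/-- The assignments `f` and `g` agree on all variables other than `u`. -/
def agreeOff (g f u : ℕ) : Fml :=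
  let v := g + f + u + 1
  let a := g + f + u + 2
  ∀ₒ v (isNat v ∧ₒ ¬ₒ v =ₒ u →ₒ ∀ₒ a (isVal g v a ↔ₒ isVal f v a))

/-- The formula `Tr^□(x)`: for every universe `U` and every assignment `f` into `U`,
`Mod(U, x, f)`. -/
def trBox (x : ℕ) : Fml :=
  let U := x + 1
  let f := x + 2
  ∀ₒ U (Fml.uni U →ₒ ∀ₒ f (isAssign f U →ₒ Fml.mod U x f))

/-- The sentence `Tr^□(⌜σ⌝)`. -/
def trBoxQuote (σ : Fml) : Fml := ∃ₒ 0 (isCode σ.code 0 ∧ₒ trBox 0)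

/-! ### The theory `CM⁻`

Free variables of axioms are read as universally quantified; the calculus below has the
generalization rule. -/

/-- Extensionality, Foundation, Pairing, Union, Power set and Infinity. -/
def zfFinite : Set Fml :=
  { ∀ₒ 0 (∀ₒ 1 ((∀ₒ 2 (2 ∈ₒ 0 ↔ₒ 2 ∈ₒ 1)) →ₒ 0 =ₒ 1)),
    ∀ₒ 0 ((∃ₒ 1 (1 ∈ₒ 0)) →ₒ ∃ₒ 1 (1 ∈ₒ 0 ∧ₒ ∀ₒ 2 (2 ∈ₒ 1 →ₒ ¬ₒ 2 ∈ₒ 0))),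
    ∀ₒ 0 (∀ₒ 1 (∃ₒ 2 (isUPair 2 0 1))),
    ∀ₒ 0 (∃ₒ 1 (∀ₒ 2 (2 ∈ₒ 1 ↔ₒ ∃ₒ 3 (3 ∈ₒ 0 ∧ₒ 2 ∈ₒ 3)))),
    ∀ₒ 0 (∃ₒ 1 (∀ₒ 2 (2 ∈ₒ 1 ↔ₒ ∀ₒ 3 (3 ∈ₒ 2 →ₒ 3 ∈ₒ 0)))),
    ∃ₒ 0 (isInductive 0) }

/-- Separation for all formulas `φ` of the language with `∈`, `Uni`, `Mod`:
`∀a ∃b ∀x (x ∈ b ↔ x ∈ a ∧ φ)`. -/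
def separation : Set Fml :=
  {χ | ∃ (φ : Fml) (x a b : ℕ), [x, a, b].Nodup ∧ b ∉ φ.fv ∧
    χ = ∀ₒ a (∃ₒ b (∀ₒ x (x ∈ₒ b ↔ₒ (x ∈ₒ a ∧ₒ φ))))}

/-- Replacement for all formulas `φ` of the language with `∈`, `Uni`, `Mod`: if for each `x ∈ a`
there is at most one `y` with `φ`, then `{y | ∃ x ∈ a, φ}` is a set. -/
def replacement : Set Fml :=
  {χ | ∃ (φ : Fml) (x y z a b : ℕ), [x, y, z, a, b].Nodup ∧ z ∉ φ.fv ∧ b ∉ φ.fv ∧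
    χ = ∀ₒ a ((∀ₒ x (x ∈ₒ a →ₒ ∃ₒ z (∀ₒ y (φ →ₒ y =ₒ z)))) →ₒ
      ∃ₒ b (∀ₒ y (y ∈ₒ b ↔ₒ ∃ₒ x (x ∈ₒ a ∧ₒ φ))))}

/-- `ZF` with Separation and Replacement for the language with `∈`, `Uni`, `Mod`. -/
def zfUniMod : Set Fml := zfFinite ∪ separation ∪ replacement

/-- `Mod(U, ⌜xᵢ = xⱼ⌝, f) ↔ f(xᵢ) = f(xⱼ)`.
Here `U, f, c, i, j` are the variables `0, 1, 2, 3, 4`. -/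
def cmEq : Fml :=
  ∀ₒ 0 (Fml.uni 0 →ₒ ∀ₒ 1 (isAssign 1 0 →ₒ ∀ₒ 3 (∀ₒ 4 (isNat 3 ∧ₒ isNat 4 →ₒ
    ∀ₒ 2 (isEqCode 2 3 4 →ₒ
      (Fml.mod 0 2 1 ↔ₒ ∃ₒ 5 (isVal 1 3 5 ∧ₒ isVal 1 4 5)))))))

/-- `Mod(U, ¬φ, f) ↔ ¬ Mod(U, φ, f)`.  Here `U, f, c, φ` are the variables `0, 1, 2, 3`. -/
def cmNeg : Fml :=
  ∀ₒ 0 (Fml.uni 0 →ₒ ∀ₒ 3 (isForm 3 →ₒ ∀ₒ 1 (isAssign 1 0 →ₒ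
    ∀ₒ 2 (isNegCode 2 3 →ₒ (Fml.mod 0 2 1 ↔ₒ ¬ₒ Fml.mod 0 3 1)))))

/-- `Mod(U, φ ∧ ψ, f) ↔ Mod(U, φ, f) ∧ Mod(U, ψ, f)`.
Here `U, f, c, φ, ψ` are the variables `0, 1, 2, 3, 4`. -/
def cmAnd : Fml :=
  ∀ₒ 0 (Fml.uni 0 →ₒ ∀ₒ 3 (∀ₒ 4 (isForm 3 ∧ₒ isForm 4 →ₒ ∀ₒ 1 (isAssign 1 0 →ₒ
    ∀ₒ 2 (isAndCode 2 3 4 →ₒ (Fml.mod 0 2 1 ↔ₒ (Fml.mod 0 3 1 ∧ₒ Fml.mod 0 4 1)))))))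

/-- `Mod(U, ∀u φ, f) ↔ Mod(U, φ, g)` for all assignments `g` into `U` that agree with `f` off `u`.
Here `U, f, c, φ, u, g` are the variables `0, 1, 2, 3, 4, 5`. -/
def cmAll : Fml :=
  ∀ₒ 0 (Fml.uni 0 →ₒ ∀ₒ 3 (isForm 3 →ₒ ∀ₒ 4 (isNat 4 →ₒ ∀ₒ 1 (isAssign 1 0 →ₒ
    ∀ₒ 2 (isAllCode 2 4 3 →ₒ
      (Fml.mod 0 2 1 ↔ₒ ∀ₒ 5 (isAssign 5 0 ∧ₒ agreeOff 5 1 4 →ₒ Fml.mod 0 3 5)))))))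

/-- `CM⁻`, compositional satisfaction for the multiverse. -/
def cmMinus : Set Fml := zfUniMod ∪ {cmEq, cmNeg, cmAnd, cmAll}

/-- Universes, being domains of structures, are nonempty: `∀ U ∈ Uni ∃ x, x ∈ U`. -/
def universesNonempty : Fml := ∀ₒ 0 (Fml.uni 0 →ₒ ∃ₒ 1 (1 ∈ₒ 0))

/-- Non-Triviality: `∃ U, Uni(U)`. -/
def nonTriviality : Fml := ∃ₒ 0 (Fml.uni 0)

/-- The schema `T_CM`: `Tr^□(⌜σ⌝) → σ`, for all sentences `σ`. -/
def schemaT : Set Fml := {χ | ∃ σ : Fml, σ.IsSentence ∧ χ = (trBoxQuote σ →ₒ σ)}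

/-- The schema `4_CM`: `Tr^□(⌜σ⌝) → Tr^□(⌜Tr^□(⌜σ⌝)⌝)`, for all sentences `σ`. -/
def schema4 : Set Fml :=
  {χ | ∃ σ : Fml, σ.IsSentence ∧ χ = (trBoxQuote σ →ₒ trBoxQuote (trBoxQuote σ))}

/-! ### Provability -/

/-- `NecProvable A φ`: the formula `φ` is derivable from the axioms `A` in classical first-order
logic with equality (in a Hilbert calculus) together with the rule `NEC`, which may be applied to
every sentence that has been derived. -/
inductive NecProvable (A : Set Fml) : Fml → Prop
  | ax {φ : Fml} : φ ∈ A → NecProvable A φ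
  | taut {φ : Fml} : φ.IsTautology → NecProvable A φ
  | inst (φ : Fml) (x y : ℕ) : NecProvable A (∀ₒ x φ →ₒ φ.subst1 x y)
  | dist (φ ψ : Fml) (x : ℕ) : x ∉ φ.fv →
      NecProvable A (∀ₒ x (φ →ₒ ψ) →ₒ (φ →ₒ ∀ₒ x ψ))
  | eqRefl (x : ℕ) : NecProvable A (x =ₒ x)
  | eqSubst (φ : Fml) (x y z : ℕ) :
      NecProvable A (x =ₒ y →ₒ (φ.subst1 z x →ₒ φ.subst1 z y))
  | mp {φ ψ : Fml} : NecProvable A (φ →ₒ ψ) → NecProvable A φ → NecProvable A ψ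
  | gen {φ : Fml} (x : ℕ) : NecProvable A φ → NecProvable A (∀ₒ x φ)
  | nec {φ : Fml} : φ.IsSentence → NecProvable A φ → NecProvable A (trBoxQuote φ)

/-- The system with axioms `A` and the rule `NEC` is inconsistent. -/
def NecInconsistent (A : Set Fml) : Prop :=
  ∃ φ : Fml, NecProvable A φ ∧ NecProvable A (¬ₒ φ)

end Multiverse

namespace Multiverse

open Function

/-! ### Substitution of variables, and countability of the set of formulas -/

namespace Fml

/-! Let λ be a liar sentence, equivalent to ¬Tr(⌜λ⌝). If ¬Tr(⌜λ⌝) is provable, then so is λ, and NEC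
gives Tr(⌜λ⌝), a contradiction (`necInconsistent_of_not_trBoxQuote_liar`). So it suffices to refute
Tr(⌜λ⌝). With T this is immediate: Tr(⌜λ⌝) implies λ, which implies ¬Tr(⌜λ⌝). With 4, apply NEC to
the theorem λ → ¬Tr(⌜λ⌝) and take a universe U with an assignment, which exists because U is
nonempty. If Tr(⌜λ⌝), then U satisfies λ, Tr(⌜λ⌝) (by 4) and λ → ¬Tr(⌜λ⌝), against the clauses for ¬
and ∧.

Formal derivations are avoided by a completeness theorem (`NecProvable.of_models`): all theorems,
those obtained by NEC included, are treated as axioms of a first-order theory, and a formula valid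
in all its models is again a theorem. Everything else is ordinary reasoning in a model of set
theory. The model may be nonstandard, so codes are handled by external induction on actual formulas
and codes.

For self-reference (`sat_liar`), each code c has a formula `name c` that defines it, and the
diagonalization of φ is ∃x₀ (`name` ⌜φ⌝ ∧ φ). No substitution is performed on codes: variables are
shifted by ∃x₀ (x₀ = xᵢ ∧ …), so the code of `name c` obeys a plain recursion on c, which is
expressed by the existence of a set that records a computation. -/

theorem subst_congr {ρ ρ' : ℕ → ℕ} {φ : Fml} (h : ∀ i ∈ φ.fv, ρ i = ρ' i) :
    subst ρ φ = subst ρ' φ := by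
  induction φ generalizing ρ ρ' with
  | eq i j => simp_all [fv, subst]
  | mem i j => simp_all [fv, subst]
  | uni i => simp_all [fv, subst]
  | mod i j k => simp_all [fv, subst]
  | neg φ ih => simp only [subst, ih h]
  | and φ ψ ih₁ ih₂ =>
    simp only [fv, Finset.mem_union] at h
    simp only [subst, ih₁ fun i hi => h i (Or.inl hi), ih₂ fun i hi => h i (Or.inr hi)]
  | all i φ ih =>
    simp only [fv] at h
    have him : ((fv φ).erase i).image ρ = ((fv φ).erase i).image ρ' :=
      Finset.image_congr fun j hj => h j hj
    simp only [subst, him]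
    congr 1
    apply ih
    intro j hj
    by_cases hji : j = i
    · simp [hji]
    · simp [hji, h j (Finset.mem_erase.2 ⟨hji, hj⟩)]

theorem fresh_notMem (s : Finset ℕ) : s.sup id + 1 ∉ s := fun h => by
  have := Finset.le_sup (f := id) h
  simp only [id] at this
  omega

theorem image_update_erase (s : Finset ℕ) (ρ : ℕ → ℕ) (i z : ℕ)
    (hz : z ∉ (s.erase i).image ρ) :
    (s.image (update ρ i z)).erase z = (s.erase i).image ρ := by
  ext j
  simp only [Finset.mem_erase, Finset.mem_image, not_exists, not_and] at *
  constructor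
  · rintro ⟨hj, k, hk, rfl⟩
    have hki : k ≠ i := by rintro rfl; simp at hj
    exact ⟨k, ⟨hki, hk⟩, by simp [hki]⟩
  · rintro ⟨k, hk, rfl⟩
    exact ⟨fun e => hz k hk e, k, hk.2, by simp [hk.1]⟩

theorem fv_subst (ρ : ℕ → ℕ) (φ : Fml) : (subst ρ φ).fv = φ.fv.image ρ := by
  induction φ generalizing ρ with
  | eq i j => simp [fv, subst, Finset.image_insert]
  | mem i j => simp [fv, subst, Finset.image_insert]
  | uni i => simp [fv, subst]
  | mod i j k => simp [fv, subst, Finset.image_insert]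
  | neg φ ih => simp [fv, subst, ih]
  | and φ ψ ih₁ ih₂ => simp [fv, subst, ih₁, ih₂, Finset.image_union]
  | all i φ ih =>
    simp only [fv, subst, ih]
    exact image_update_erase _ _ _ _ (fresh_notMem _)

/-- The new bound variable depends only on the image of the free variables, which is the same set on
both sides. Hence the equality is syntactic and not merely up to renaming. -/
theorem subst_subst (σ ρ : ℕ → ℕ) (φ : Fml) : subst σ (subst ρ φ) = subst (σ ∘ ρ) φ := by
  induction φ generalizing σ ρ with
  | eq i j => simp [subst]
  | mem i j => simp [subst]
  | uni i => simp [subst]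
  | mod i j k => simp [subst]
  | neg φ ih => simp [subst, ih]
  | and φ ψ ih₁ ih₂ => simp [subst, ih₁, ih₂]
  | all i φ ih =>
    have hz := fresh_notMem (((fv φ).erase i).image ρ)
    simp only [subst, fv_subst, ih, image_update_erase _ _ _ _ hz, Finset.image_image]
    congr 1
    apply subst_congr
    intro j hj
    by_cases hji : j = i
    · subst hji; simp
    · have : ρ j ≠ (((fv φ).erase i).image ρ).sup id + 1 := fun e =>
        hz (e ▸ Finset.mem_image_of_mem _ (Finset.mem_erase.2 ⟨hji, hj⟩))
      rw [comp_apply, update_of_ne hji, update_of_ne this, update_of_ne hji, comp_apply]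

/-- An injective numbering of formulas. -/
def toNat : Fml → ℕ
  | eq i j => Nat.pair 0 (Nat.pair i j)
  | mem i j => Nat.pair 1 (Nat.pair i j)
  | uni i => Nat.pair 2 i
  | mod i j k => Nat.pair 3 (Nat.pair i (Nat.pair j k))
  | neg φ => Nat.pair 4 φ.toNat
  | and φ ψ => Nat.pair 5 (Nat.pair φ.toNat ψ.toNat)
  | all i φ => Nat.pair 6 (Nat.pair i φ.toNat)

theorem toNat_injective : Injective toNat := by
  intro φ
  induction φ with
  | neg φ ih =>
    intro ψ h; cases ψ <;> simp [toNat, Nat.pair_eq_pair] at h ⊢; exact ih h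
  | and φ φ' ih ih' =>
    intro ψ h; cases ψ <;> simp [toNat, Nat.pair_eq_pair] at h ⊢; exact ⟨ih h.1, ih' h.2⟩
  | all i φ ih =>
    intro ψ h; cases ψ <;> simp [toNat, Nat.pair_eq_pair] at h ⊢; exact ⟨h.1, ih h.2⟩
  | _ => intro ψ h; cases ψ <;> simp_all [toNat, Nat.pair_eq_pair]

instance : Countable Fml := toNat_injective.countable

instance : Nonempty Fml := ⟨eq 0 0⟩

end Fml

/-! ### Semantics -/

/-- Structures for the language with `∈`, `Uni`, `Mod`. -/
structure Str (M : Type) where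
  mem : M → M → Prop
  uni : M → Prop
  mod : M → M → M → Prop

/-- Tarskian satisfaction. -/
def Sat {M : Type} (S : Str M) : (ℕ → M) → Fml → Prop
  | v, .eq i j => v i = v j
  | v, .mem i j => S.mem (v i) (v j)
  | v, .uni i => S.uni (v i)
  | v, .mod i j k => S.mod (v i) (v j) (v k)
  | v, .neg φ => ¬ Sat S v φ
  | v, .and φ ψ => Sat S v φ ∧ Sat S v ψ
  | v, .all i φ => ∀ a, Sat S (update v i a) φ

section Sat

variable {M : Type} {S : Str M} {v : ℕ → M}

@[simp] theorem sat_eq {i j : ℕ} : Sat S v (i =ₒ j) ↔ v i = v j := Iff.rfl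
@[simp] theorem sat_mem {i j : ℕ} : Sat S v (i ∈ₒ j) ↔ S.mem (v i) (v j) := Iff.rfl
@[simp] theorem sat_uni {i : ℕ} : Sat S v (Fml.uni i) ↔ S.uni (v i) := Iff.rfl
@[simp] theorem sat_mod {i j k : ℕ} : Sat S v (Fml.mod i j k) ↔ S.mod (v i) (v j) (v k) := Iff.rfl
@[simp] theorem sat_neg {φ : Fml} : Sat S v (¬ₒ φ) ↔ ¬ Sat S v φ := Iff.rfl
@[simp] theorem sat_and {φ ψ : Fml} : Sat S v (φ ∧ₒ ψ) ↔ Sat S v φ ∧ Sat S v ψ := Iff.rfl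
@[simp] theorem sat_all {i : ℕ} {φ : Fml} :
    Sat S v (∀ₒ i φ) ↔ ∀ a, Sat S (update v i a) φ := Iff.rfl
@[simp] theorem sat_imp {φ ψ : Fml} : Sat S v (φ →ₒ ψ) ↔ (Sat S v φ → Sat S v ψ) := by
  simp [Fml.imp]
@[simp] theorem sat_or {φ ψ : Fml} : Sat S v (φ ∨ₒ ψ) ↔ (Sat S v φ ∨ Sat S v ψ) := by
  simp only [Fml.or, sat_neg, sat_and]; tauto
@[simp] theorem sat_iff {φ ψ : Fml} : Sat S v (φ ↔ₒ ψ) ↔ (Sat S v φ ↔ Sat S v ψ) := by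
  simp only [Fml.iff, sat_imp, sat_and]; tauto
@[simp] theorem sat_ex {i : ℕ} {φ : Fml} :
    Sat S v (∃ₒ i φ) ↔ ∃ a, Sat S (update v i a) φ := by
  simp [Fml.ex]

theorem sat_congr {φ : Fml} {v w : ℕ → M} (h : ∀ i ∈ φ.fv, v i = w i) :
    Sat S v φ ↔ Sat S w φ := by
  induction φ generalizing v w with
  | eq i j => simp_all [Fml.fv]
  | mem i j => simp_all [Fml.fv]
  | uni i => simp_all [Fml.fv]
  | mod i j k => simp_all [Fml.fv]
  | neg φ ih => exact not_congr (ih h)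
  | and φ ψ ih₁ ih₂ =>
    simp only [Fml.fv, Finset.mem_union] at h
    exact and_congr (ih₁ fun i hi => h i (Or.inl hi)) (ih₂ fun i hi => h i (Or.inr hi))
  | all i φ ih =>
    refine forall_congr' fun a => ih fun j hj => ?_
    by_cases hji : j = i
    · simp [hji]
    · simp [hji, h j (Finset.mem_erase.2 ⟨hji, hj⟩)]

end Sat

/-- Universal quantification over a list of variables. -/
def Fml.close (l : List ℕ) (φ : Fml) : Fml := l.foldr Fml.all φ

/-- Passes from truth of a closure under one assignment to truth of the formula under all others. -/
theorem sat_of_sat_close {M : Type} {S : Str M} {φ : Fml} {l : List ℕ} {v w : ℕ → M}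
    (h : Sat S v (φ.close l)) (hw : ∀ i ∉ l, i ∈ φ.fv → w i = v i) : Sat S w φ := by
  induction l generalizing v with
  | nil => exact (sat_congr fun i hi => hw i (by simp) hi).2 h
  | cons i l ih =>
    refine ih (h (w i)) fun j hj hf => ?_
    by_cases hji : j = i
    · simp [hji]
    · simp [hji, hw j (by simp [hji, hj]) hf]

/-! ### Completeness of the calculus -/

section Completeness

variable {A : Set Fml}

open Fml NecProvable

theorem NecProvable.close {φ : Fml} (h : NecProvable A φ) (l : List ℕ) :
    NecProvable A (φ.close l) := by
  induction l with
  | nil => exact h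
  | cons i l ih => exact ih.gen i

theorem NecProvable.of_taut₁ {φ ψ : Fml} (h : NecProvable A φ)
    (ht : (φ →ₒ ψ).IsTautology) : NecProvable A ψ := mp (taut ht) h

theorem NecProvable.of_taut₂ {φ χ ψ : Fml} (h : NecProvable A φ) (h' : NecProvable A χ)
    (ht : (φ →ₒ χ →ₒ ψ).IsTautology) : NecProvable A ψ := mp (mp (taut ht) h) h'

theorem NecProvable.imp_trans {φ χ ψ : Fml} (h : NecProvable A (φ →ₒ χ))
    (h' : NecProvable A (χ →ₒ ψ)) : NecProvable A (φ →ₒ ψ) :=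
  of_taut₂ h h' fun V hn ha => by simp only [imp, hn, ha]; tauto

theorem NecProvable.imp_all {φ ψ : Fml} {x : ℕ} (hx : x ∉ φ.fv)
    (h : NecProvable A (φ →ₒ ψ)) : NecProvable A (φ →ₒ ∀ₒ x ψ) :=
  mp (dist φ ψ x hx) (h.gen x)

theorem subst1_subst1_of_notMem {φ : Fml} {x y : ℕ} (hy : y ∉ (Fml.all x φ).fv) :
    (φ.subst1 x y).subst1 y x = subst id φ := by
  rw [subst1, subst1, subst_subst]
  refine subst_congr fun j hj => ?_
  by_cases hjx : j = x
  · simp [hjx]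
  · have : j ≠ y := by rintro rfl; exact hy (Finset.mem_erase.2 ⟨hjx, hj⟩)
    simp [hjx, this]

/-- `subst id` renames bound variables, so it is not the identity on syntax. In the quantifier case,
renaming to a fresh variable and back gives `subst id` of the matrix, to which the induction
hypothesis applies. -/
theorem provable_subst_id (φ : Fml) :
    NecProvable A (φ →ₒ subst id φ) ∧ NecProvable A (subst id φ →ₒ φ) := by
  induction φ with
  | neg φ ih =>
    exact ⟨of_taut₁ ih.2 fun V hn ha => by simp only [subst, imp, hn, ha]; tauto,
      of_taut₁ ih.1 fun V hn ha => by simp only [subst, imp, hn, ha]; tauto⟩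
  | and φ ψ ih ih' =>
    exact ⟨of_taut₂ ih.1 ih'.1 fun V hn ha => by simp only [subst, imp, hn, ha]; tauto,
      of_taut₂ ih.2 ih'.2 fun V hn ha => by simp only [subst, imp, hn, ha]; tauto⟩
  | all i φ ih =>
    have hz : (((fv φ).erase i).image id).sup id + 1 ∉ (Fml.all i φ).fv := by
      simpa [fv] using fresh_notMem ((fv φ).erase i)
    have hi : i ∉ (subst id (Fml.all i φ)).fv := by simp [fv_subst, fv]
    simp only [subst] at hi ⊢
    refine ⟨imp_all hz (inst φ i _), imp_all hi (imp_trans (inst _ _ i) ?_)⟩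
    have := subst1_subst1_of_notMem hz
    exact cast (congrArg (fun χ => NecProvable A (χ →ₒ φ)) this.symm) ih.2
  | _ => exact ⟨taut fun V hn ha => by simp [subst, imp, hn, ha],
      taut fun V hn ha => by simp [subst, imp, hn, ha]⟩

theorem provable_all_rename {φ : Fml} {x y : ℕ} (hy : y ∉ (Fml.all x φ).fv) :
    NecProvable A (∀ₒ y (φ.subst1 x y) →ₒ ∀ₒ x φ) := by
  refine imp_all ?_ (imp_trans (inst _ y x) (subst1_subst1_of_notMem hy ▸ (provable_subst_id φ).2))
  simp only [fv, subst1, fv_subst, Finset.mem_erase, Finset.mem_image, not_and, not_exists]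
  intro hxy j hj
  by_cases h : j = x
  · rw [h, update_self]; exact hxy.symm
  · rwa [update_of_ne h]

/-- A step of the Henkin construction: decide the formula `θ`, adding a counterexample when a
universal formula is refuted. -/
theorem exists_henkin_step {χ : Fml} (h : ¬ NecProvable A (¬ₒ χ)) (θ : Fml) :
    ∃ χ', ¬ NecProvable A (¬ₒ χ') ∧ NecProvable A (χ' →ₒ χ) ∧
      (NecProvable A (χ' →ₒ θ) ∨ NecProvable A (χ' →ₒ ¬ₒ θ) ∧
        ∀ x ψ, θ = Fml.all x ψ → ∃ y, NecProvable A (χ' →ₒ ¬ₒ ψ.subst1 x y)) := by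
  by_cases h₁ : NecProvable A (¬ₒ (χ ∧ₒ θ))
  · by_cases h₂ : ∃ x ψ, θ = Fml.all x ψ
    · obtain ⟨x, ψ, rfl⟩ := h₂
      -- The theory so far is a single formula, so a variable fresh for it exists and no Henkin
      -- constants are needed.
      set y := (χ.fv ∪ (Fml.all x ψ).fv).sup id + 1 with hy
      have hf : y ∉ χ.fv ∪ (Fml.all x ψ).fv := fresh_notMem _
      rw [Finset.mem_union, not_or] at hf
      refine ⟨χ ∧ₒ (¬ₒ ψ.subst1 x y), fun h₃ => h ?_,
        taut fun V hn ha => by simp only [imp, hn, ha]; tauto, Or.inr ⟨?_, ?_⟩⟩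
      -- If the new formula were refutable, χ would imply the instance at the fresh `y`, hence the
      -- universal formula that it refutes.
      · have h₄ : NecProvable A (χ →ₒ ψ.subst1 x y) :=
          of_taut₁ h₃ fun V hn ha => by simp only [imp, hn, ha]; tauto
        have h₅ := imp_trans (imp_all hf.1 h₄) (provable_all_rename hf.2)
        exact of_taut₂ h₁ h₅ fun V hn ha => by simp only [imp, hn, ha]; tauto
      · exact of_taut₁ h₁ fun V hn ha => by simp only [imp, hn, ha]; tauto
      · rintro _ _ ⟨⟩
        exact ⟨y, taut fun V hn ha => by simp only [imp, hn, ha]; tauto⟩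
    · refine ⟨χ, h, taut fun V hn ha => by simp only [imp, hn, ha]; tauto, Or.inr ⟨?_, ?_⟩⟩
      · exact of_taut₁ h₁ fun V hn ha => by simp only [imp, hn, ha]; tauto
      · exact fun x ψ e => (h₂ ⟨x, ψ, e⟩).elim
  · exact ⟨χ ∧ₒ θ, h₁, taut fun V hn ha => by simp only [imp, hn, ha]; tauto,
      Or.inl (taut fun V hn ha => by simp only [imp, hn, ha]; tauto)⟩

/-- Complete theories with witnesses that contain all provable formulas. -/
structure IsHenkin (A : Set Fml) (Γ : Set Fml) : Prop where
  provable {φ : Fml} : NecProvable A φ → φ ∈ Γ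
  mp {φ ψ : Fml} : (φ →ₒ ψ) ∈ Γ → φ ∈ Γ → ψ ∈ Γ
  neg_iff {φ : Fml} : (¬ₒ φ) ∈ Γ ↔ φ ∉ Γ
  witness {x : ℕ} {φ : Fml} : (∀ y, φ.subst1 x y ∈ Γ) → Fml.all x φ ∈ Γ

/-- Starting from ¬φ, the n-th step decides the n-th formula. Each stage is one consistent formula
that implies the earlier ones, and Γ collects the consequences of all stages. -/
theorem exists_isHenkin {φ : Fml} (h : ¬ NecProvable A φ) :
    ∃ Γ, IsHenkin A Γ ∧ φ ∉ Γ := by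
  obtain ⟨θ, hθ⟩ := exists_surjective_nat Fml
  choose step hcons himp hdec using fun (χ : {χ : Fml // ¬ NecProvable A (¬ₒ χ)}) (n : ℕ) =>
    exists_henkin_step χ.2 (θ n)
  have h₀ : ¬ NecProvable A (¬ₒ ¬ₒ φ) := fun h' =>
    h (of_taut₁ h' fun V hn ha => by simp only [imp, hn, ha]; tauto)
  let χ : ℕ → {χ : Fml // ¬ NecProvable A (¬ₒ χ)} :=
    fun n => n.rec ⟨¬ₒ φ, h₀⟩ fun n c => ⟨step c n, hcons c n⟩
  have hmono : ∀ m n, m ≤ n → NecProvable A ((χ n).1 →ₒ (χ m).1) := by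
    intro m n hmn
    induction n, hmn using Nat.le_induction with
    | base => exact taut fun V hn ha => by simp only [imp, hn, ha]; tauto
    | succ n _ ih => exact imp_trans (himp (χ n) n) ih
  have hcon : ∀ ψ m n, NecProvable A ((χ m).1 →ₒ ψ) → NecProvable A ((χ n).1 →ₒ ¬ₒ ψ) →
      False := by
    intro ψ m n h₁ h₂
    refine (χ (max m n)).2 (of_taut₂ (imp_trans (hmono _ _ (le_max_left m n)) h₁)
      (imp_trans (hmono _ _ (le_max_right m n)) h₂) fun V hn ha => ?_)
    simp only [imp, hn, ha]; tauto
  refine ⟨{ψ | ∃ n, NecProvable A ((χ n).1 →ₒ ψ)}, ⟨?_, ?_, ?_, ?_⟩, ?_⟩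
  · exact fun hψ => ⟨0, of_taut₁ hψ fun V hn ha => by simp only [imp, hn, ha]; tauto⟩
  · rintro α β ⟨m, hm⟩ ⟨n, hn⟩
    refine ⟨max m n, of_taut₂ (imp_trans (hmono _ _ (le_max_left m n)) hm)
      (imp_trans (hmono _ _ (le_max_right m n)) hn) fun V hn ha => ?_⟩
    simp only [imp, hn, ha]; tauto
  · intro ψ
    constructor
    · rintro ⟨n, hn⟩ ⟨m, hm⟩
      exact hcon ψ m n hm hn
    · intro hψ
      obtain ⟨n, rfl⟩ := hθ ψ
      rcases hdec (χ n) n with h' | h'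
      · exact (hψ ⟨n + 1, h'⟩).elim
      · exact ⟨n + 1, h'.1⟩
  · intro x ψ hψ
    obtain ⟨n, hn⟩ := hθ (Fml.all x ψ)
    rcases hdec (χ n) n with h' | h'
    · exact ⟨n + 1, hn ▸ h'⟩
    · obtain ⟨y, hy⟩ := h'.2 x ψ hn
      obtain ⟨m, hm⟩ := hψ y
      exact (hcon _ m (n + 1) hm hy).elim
  · rintro ⟨n, hn⟩
    exact hcon φ n 0 hn (taut (φ := (¬ₒ φ) →ₒ ¬ₒ φ) fun V hn ha => by
      simp only [imp, hn, ha]; tauto)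

/-! ### The term model of a Henkin theory -/

namespace IsHenkin

variable {Γ : Set Fml} (H : IsHenkin A Γ)
include H

theorem of_taut₁ {φ ψ : Fml} (h : φ ∈ Γ) (ht : (φ →ₒ ψ).IsTautology) : ψ ∈ Γ :=
  H.mp (H.provable (taut ht)) h

theorem and_iff {φ ψ : Fml} : (φ ∧ₒ ψ) ∈ Γ ↔ φ ∈ Γ ∧ ψ ∈ Γ := by
  refine ⟨fun h => ⟨H.of_taut₁ h fun V hn ha => ?_, H.of_taut₁ h fun V hn ha => ?_⟩, fun h =>
    H.mp (H.mp (H.provable (taut (φ := φ →ₒ ψ →ₒ φ ∧ₒ ψ) fun V hn ha => ?_)) h.1) h.2⟩ <;>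
  · simp only [imp, hn, ha]; tauto

theorem all_iff {φ : Fml} {x : ℕ} : Fml.all x φ ∈ Γ ↔ ∀ y, φ.subst1 x y ∈ Γ :=
  ⟨fun h y => H.mp (H.provable (inst φ x y)) h, H.witness⟩

theorem refl (i : ℕ) : (i =ₒ i) ∈ Γ := H.provable (eqRefl i)

theorem rewrite {φ : Fml} {x y : ℕ} (z : ℕ) (h : (x =ₒ y) ∈ Γ) (hx : φ.subst1 z x ∈ Γ) :
    φ.subst1 z y ∈ Γ := H.mp (H.mp (H.provable (eqSubst φ x y z)) h) hx

theorem symm {i j : ℕ} (h : (i =ₒ j) ∈ Γ) : (j =ₒ i) ∈ Γ := by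
  have := H.rewrite (φ := (i + 1) =ₒ i) (i + 1) h
  simp only [subst1, Fml.subst, update_self, ne_eq, Nat.left_eq_add, one_ne_zero,
    not_false_eq_true, update_of_ne, id] at this
  exact this (H.refl i)

theorem trans {i j k : ℕ} (h : (i =ₒ j) ∈ Γ) (h' : (j =ₒ k) ∈ Γ) : (i =ₒ k) ∈ Γ := by
  have := H.rewrite (φ := i =ₒ (i + 1)) (i + 1) h'
  simp only [subst1, Fml.subst, update_self, ne_eq, Nat.left_eq_add, one_ne_zero,
    not_false_eq_true, update_of_ne, id] at this
  exact this h

/-- A substitution instance of a formula depends only on the classes of the substituted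
variables modulo provable equality. -/
theorem subst_iff {φ : Fml} {ρ ρ' : ℕ → ℕ} (h : ∀ i, (ρ i =ₒ ρ' i) ∈ Γ) :
    subst ρ φ ∈ Γ → subst ρ' φ ∈ Γ := by
  -- The equality axiom replaces one variable at a time, so ρ is changed to ρ' along a finite set
  -- that grows to the free variables.
  suffices ∀ s : Finset ℕ, subst ρ φ ∈ Γ → subst (fun i => if i ∈ s then ρ' i else ρ i) φ ∈ Γ by
    intro h'
    refine cast ?_ (this φ.fv h')
    congr 1
    exact subst_congr fun i hi => by simp [hi]
  intro s h'
  induction s using Finset.induction_on with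
  | empty => simpa using h'
  | insert a s ha ih =>
    set τ : ℕ → ℕ := fun i => if i ∈ s then ρ' i else ρ i with hτ
    set z := (φ.fv.image τ).sup id + 1 with hz
    have hzn : z ∉ φ.fv.image τ := fresh_notMem _
    have key : ∀ y, (subst (update τ a z) φ).subst1 z y = subst (update τ a y) φ := by
      intro y
      rw [subst1, subst_subst]
      refine subst_congr fun j hj => ?_
      by_cases hja : j = a
      · simp [hja]
      · have : τ j ≠ z := fun e => hzn (e ▸ Finset.mem_image_of_mem _ hj)
        simp [hja, this]
    have := H.rewrite (φ := subst (update τ a z) φ) z (h a)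
    rw [key, key] at this
    have e₁ : update τ a (ρ a) = τ := by
      ext j; by_cases hja : j = a
      · subst hja; simp [hτ, ha]
      · simp [hja]
    have e₂ : update τ a (ρ' a) = fun i => if i ∈ insert a s then ρ' i else ρ i := by
      ext j; by_cases hja : j = a
      · subst hja; simp
      · simp [hja, hτ]
    rw [e₁, e₂] at this
    exact this ih

/-- Provable equality of variables. -/
def setoid : Setoid ℕ where
  r i j := (i =ₒ j) ∈ Γ
  iseqv := ⟨H.refl, H.symm, H.trans⟩

/-- The term model. -/
def model : Str (Quotient H.setoid) where
  mem a b := (a.out ∈ₒ b.out) ∈ Γ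
  uni a := Fml.uni a.out ∈ Γ
  mod a b c := Fml.mod a.out b.out c.out ∈ Γ

/-- The truth lemma. Every element is the class of a variable, so the quantifier case is `all_iff`;
`subst_iff` bridges a variable and the chosen representative of its class. -/
theorem sat_model (φ : Fml) (v : ℕ → Quotient H.setoid) :
    Sat H.model v φ ↔ subst (fun i => (v i).out) φ ∈ Γ := by
  induction φ generalizing v with
  | eq i j => exact Quotient.out_equiv_out.symm
  | mem i j => exact Iff.rfl
  | uni i => exact Iff.rfl
  | mod i j k => exact Iff.rfl
  | neg φ ih => rw [sat_neg, ih]; exact H.neg_iff.symm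
  | and φ ψ ih ih' => rw [sat_and, ih, ih']; exact H.and_iff.symm
  | all i φ ih =>
    set ρ : ℕ → ℕ := fun i => (v i).out with hρ
    have hz := fresh_notMem (((fv φ).erase i).image ρ)
    have key : ∀ y, (subst (update ρ i ((((fv φ).erase i).image ρ).sup id + 1)) φ).subst1
        ((((fv φ).erase i).image ρ).sup id + 1) y = subst (update ρ i y) φ := by
      intro y
      rw [subst1, subst_subst]
      refine subst_congr fun j hj => ?_
      by_cases hji : j = i
      · simp [hji]
      · have : ρ j ≠ (((fv φ).erase i).image ρ).sup id + 1 := fun e =>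
          hz (e ▸ Finset.mem_image_of_mem _ (Finset.mem_erase.2 ⟨hji, hj⟩))
        rw [comp_apply, update_of_ne hji, update_of_ne this, update_of_ne hji, id]
    have hout : ∀ a : Quotient H.setoid, (fun j => (update v i a j).out) = update ρ i a.out := by
      intro a; ext j; by_cases hji : j = i
      · subst hji; simp
      · simp [hji, hρ]
    simp only [subst, H.all_iff, key, sat_all, ih, hout]
    constructor
    · intro h y
      refine H.subst_iff (fun j => ?_) (h (Quotient.mk _ y))
      by_cases hji : j = i
      · subst hji; simp only [update_self]; exact Quotient.mk_out (s := H.setoid) y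
      · simp only [ne_eq, hji, not_false_eq_true, update_of_ne]; exact H.refl _
    · exact fun h a => h _

end IsHenkin

/-- Completeness: a formula that holds in all structures in which all provable formulas are valid
is provable. -/
theorem NecProvable.of_models {φ : Fml}
    (h : ∀ (M : Type) (S : Str M) (_ : Nonempty M),
      (∀ ψ, NecProvable A ψ → ∀ v, Sat S v ψ) → ∀ v, Sat S v φ) :
    NecProvable A φ := by
  by_contra hφ
  obtain ⟨Γ, H, hΓ⟩ := exists_isHenkin (fun h' => hφ h' : ¬ NecProvable A φ)
  refine hΓ (H.mp (H.provable (provable_subst_id φ).2) ?_)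
  have h₁ : ∀ ψ, NecProvable A ψ → ∀ v, Sat H.model v ψ := by
    intro ψ hψ v
    -- Theorems are closed under generalization, so it is enough that the universal closure holds
    -- under the canonical assignment.
    refine sat_of_sat_close (v := fun i => Quotient.mk H.setoid i) (l := ψ.fv.toList) ?_
      fun i hi hf => (hi (by simpa using hf)).elim
    refine (H.sat_model _ _).2 (H.subst_iff (ρ := id) (fun i => H.symm ?_) (H.provable
      (mp (provable_subst_id _).1 (hψ.close _))))
    exact Quotient.mk_out (s := H.setoid) i
  have h₂ := (H.sat_model φ _).1 (h _ H.model ⟨Quotient.mk _ 0⟩ h₁ fun i => Quotient.mk _ i)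
  exact H.subst_iff (fun i => Quotient.mk_out (s := H.setoid) i) h₂

end Completeness

/-! ### Set theory inside a structure -/

/-- The set-theoretic facts about a structure on which the interpretation of codes rests. -/
class IsSetModel {M : Type} (S : Str M) : Prop where
  ext (a b : M) : (∀ z, S.mem z a ↔ S.mem z b) → a = b
  foundation (a : M) : (∃ x, S.mem x a) → ∃ x, S.mem x a ∧ ∀ z, S.mem z x → ¬ S.mem z a
  exists_upair (a b : M) : ∃ p, ∀ z, S.mem z p ↔ z = a ∨ z = b
  exists_union (a : M) : ∃ u, ∀ z, S.mem z u ↔ ∃ y, S.mem y a ∧ S.mem z y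
  exists_empty : ∃ e, ∀ z, ¬ S.mem z e

theorem isSetModel_of_zf {M : Type} {S : Str M} [hM : Nonempty M]
    (h : ∀ ψ ∈ zfUniMod, ∀ v, Sat S v ψ) : IsSetModel S where
  ext a b := by
    have := h _ (Or.inl (Or.inl (Or.inl rfl))) fun _ => a
    simp only [sat_all, sat_imp, sat_iff, sat_mem, sat_eq] at this
    simpa [update_apply] using this a b
  foundation a := by
    have := h _ (Or.inl (Or.inl (Or.inr (Or.inl rfl)))) fun _ => a
    simp only [sat_all, sat_imp, sat_ex, sat_and, sat_neg, sat_mem] at this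
    simpa [update_apply] using this a
  exists_upair a b := by
    have := h _ (Or.inl (Or.inl (Or.inr (Or.inr (Or.inl rfl))))) fun _ => a
    simp only [isUPair, sat_all, sat_ex, sat_iff, sat_or, sat_mem, sat_eq] at this
    simpa [update_apply] using this a b
  exists_union a := by
    have := h _ (Or.inl (Or.inl (Or.inr (Or.inr (Or.inr (Or.inl rfl)))))) fun _ => a
    simp only [sat_all, sat_ex, sat_iff, sat_and, sat_mem] at this
    simpa [update_apply] using this a
  exists_empty := by
    obtain ⟨m⟩ := hM
    -- Separation for x₀ ≠ x₀ yields the empty set.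
    have := h _ (Or.inl (Or.inr ⟨¬ₒ 0 =ₒ 0, 0, 1, 2, by decide, by decide, rfl⟩)) fun _ => m
    simp only [sat_all, sat_ex, sat_iff, sat_and, sat_neg, sat_mem, sat_eq] at this
    simpa [update_apply] using this m

/-! ### Set operations, pairs and numerals in a structure -/

namespace Str

variable {M : Type} [Nonempty M] (S : Str M)

/-- The empty set. -/
noncomputable def emp : M := Classical.epsilon fun e => ∀ z, ¬ S.mem z e

/-- The unordered pair. -/
noncomputable def upair (a b : M) : M :=
  Classical.epsilon fun p => ∀ z, S.mem z p ↔ z = a ∨ z = b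

/-- The Kuratowski pair. -/
noncomputable def pr (a b : M) : M := S.upair (S.upair a a) (S.upair a b)

/-- The union of a set. -/
noncomputable def sUnion (a : M) : M :=
  Classical.epsilon fun u => ∀ z, S.mem z u ↔ ∃ y, S.mem y a ∧ S.mem z y

/-- The union of two sets. -/
noncomputable def union (a b : M) : M := S.sUnion (S.upair a b)

/-- The successor `a ∪ {a}`. -/
noncomputable def suc (a : M) : M := S.union a (S.upair a a)

/-- The von Neumann numeral. -/
noncomputable def num : ℕ → M
  | 0 => S.emp
  | n + 1 => S.suc (num n)

/-- The set denoted by a code. -/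
noncomputable def den : Code → M
  | .num n => S.num n
  | .pair a b => S.pr (den a) (den b)

/-- Membership in every inductive set. -/
def IsNat (n : M) : Prop :=
  ∀ X, S.mem S.emp X → (∀ y, S.mem y X → S.mem (S.suc y) X) → S.mem n X

/-- `f` is a function from the natural numbers to `U`. -/
def IsAssign (f U : M) : Prop :=
  (∀ p, S.mem p f → ∃ i a, S.IsNat i ∧ S.mem a U ∧ p = S.pr i a) ∧
    ∀ i, S.IsNat i → ∃ a, S.mem (S.pr i a) f ∧ ∀ b, S.mem (S.pr i b) f → b = a

/-- Truth in all universes under all assignments. -/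
def Tr (c : M) : Prop := ∀ U, S.uni U → ∀ f, S.IsAssign f U → S.mod U c f

/-- The code of the negation of the formula coded by `a`. -/
noncomputable def cNeg (a : M) : M := S.pr (S.num 4) a

/-- The code of the conjunction of the formulas coded by `a` and `b`. -/
noncomputable def cAnd (a b : M) : M := S.pr (S.num 5) (S.pr a b)

/-- The code of the existential quantification over the variable `i` of the formula coded
by `a`. -/
noncomputable def cEx (i : ℕ) (a : M) : M :=
  S.cNeg (S.pr (S.num 6) (S.pr (S.num i) (S.cNeg a)))

variable {S} [IsSetModel S]

theorem not_mem_emp (z : M) : ¬ S.mem z S.emp :=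
  Classical.epsilon_spec (IsSetModel.exists_empty (S := S)) z

@[simp] theorem mem_upair {z a b : M} : S.mem z (S.upair a b) ↔ z = a ∨ z = b :=
  Classical.epsilon_spec (IsSetModel.exists_upair (S := S) a b) z

@[simp] theorem mem_union {z a b : M} : S.mem z (S.union a b) ↔ S.mem z a ∨ S.mem z b := by
  rw [union, sUnion, Classical.epsilon_spec (IsSetModel.exists_union (S := S) (S.upair a b)) z]
  simp

@[simp] theorem mem_suc {z a : M} : S.mem z (S.suc a) ↔ S.mem z a ∨ z = a := by
  simp [suc]

theorem eq_emp_iff {x : M} : x = S.emp ↔ ∀ z, ¬ S.mem z x :=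
  ⟨fun h => h ▸ not_mem_emp, fun h => IsSetModel.ext (S := S) _ _ fun z => by simp [h z, not_mem_emp z]⟩

theorem eq_upair_iff {x a b : M} : x = S.upair a b ↔ ∀ z, S.mem z x ↔ z = a ∨ z = b :=
  ⟨fun h => by simp [h], fun h => IsSetModel.ext (S := S) _ _ fun z => by simp [h z]⟩

theorem eq_suc_iff {x a : M} : x = S.suc a ↔ ∀ z, S.mem z x ↔ S.mem z a ∨ z = a :=
  ⟨fun h => by simp [h], fun h => IsSetModel.ext (S := S) _ _ fun z => by simp [h z]⟩

theorem mem_irrefl (x : M) : ¬ S.mem x x := fun h => by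
  obtain ⟨y, hy, h'⟩ := IsSetModel.foundation (S := S) (S.upair x x) ⟨x, by simp⟩
  simp only [mem_upair, or_self] at hy
  subst hy
  exact h' y h (by simp)

theorem mem_asymm {x y : M} (h : S.mem x y) : ¬ S.mem y x := fun h' => by
  obtain ⟨z, hz, hd⟩ := IsSetModel.foundation (S := S) (S.upair x y) ⟨x, by simp⟩
  rcases mem_upair.1 hz with rfl | rfl
  · exact hd y h' (by simp)
  · exact hd x h (by simp)

theorem upair_self_inj {a b : M} (h : S.upair a a = S.upair b b) : a = b := by
  have := (eq_upair_iff.1 h a).1 (by simp)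
  simpa using this

theorem upair_eq_upair_self {a b c : M} (h : S.upair a b = S.upair c c) : a = c ∧ b = c := by
  have h₁ := (eq_upair_iff.1 h a).1 (by simp)
  have h₂ := (eq_upair_iff.1 h b).1 (by simp)
  simpa using And.intro h₁ h₂

theorem upair_left_inj {a b c : M} (h : S.upair a b = S.upair a c) : b = c := by
  have h₁ := (eq_upair_iff.1 h b).1 (by simp)
  have h₂ := (eq_upair_iff.1 h.symm c).1 (by simp)
  rcases h₁ with rfl | rfl
  · rcases h₂ with rfl | rfl <;> rfl
  · rfl

@[simp] theorem pr_inj {a b c d : M} : S.pr a b = S.pr c d ↔ a = c ∧ b = d := by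
  refine ⟨fun h => ?_, fun h => by rw [h.1, h.2]⟩
  have hac : a = c := by
    have := (eq_upair_iff.1 h (S.upair a a)).1 (by simp [pr])
    rcases this with h' | h'
    · exact upair_self_inj h'
    · exact (upair_eq_upair_self h'.symm).1.symm
  subst hac
  exact ⟨rfl, upair_left_inj (upair_left_inj h)⟩

@[simp] theorem suc_inj {a b : M} : S.suc a = S.suc b ↔ a = b := by
  refine ⟨fun h => ?_, fun h => by rw [h]⟩
  have h₁ := (eq_suc_iff.1 h a).1 (by simp)
  have h₂ := (eq_suc_iff.1 h.symm b).1 (by simp)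
  by_contra hab
  exact mem_asymm (h₁.resolve_right hab) (h₂.resolve_right (Ne.symm hab))

@[simp] theorem suc_ne_emp (a : M) : S.suc a ≠ S.emp := fun h => eq_emp_iff.1 h a (by simp)

@[simp] theorem pr_ne_emp (a b : M) : S.pr a b ≠ S.emp := fun h =>
  eq_emp_iff.1 h (S.upair a a) (by simp [pr])

-- If {{x}, {x, y}} = a ∪ {a}, then a is one of the two members, so x ∈ a, so x is itself {x} or {x,
-- y}, and x ∈ x. This keeps pairs and numerals apart as codes.
@[simp] theorem pr_ne_suc (x y a : M) : S.pr x y ≠ S.suc a := fun h => by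
  have h₁ := eq_suc_iff.1 h
  simp only [pr, mem_upair] at h₁
  have hx : S.mem x a := by
    rcases (h₁ a).2 (by simp) with rfl | rfl <;> simp
  rcases (h₁ x).2 (Or.inl hx) with h₂ | h₂
  · exact mem_irrefl x ((eq_upair_iff.1 h₂ x).2 (Or.inl rfl))
  · exact mem_irrefl x ((eq_upair_iff.1 h₂ x).2 (Or.inl rfl))

@[simp] theorem emp_ne_suc (a : M) : S.emp ≠ S.suc a := (suc_ne_emp a).symm
@[simp] theorem emp_ne_pr (a b : M) : S.emp ≠ S.pr a b := (pr_ne_emp a b).symm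
@[simp] theorem suc_ne_pr (x y a : M) : S.suc a ≠ S.pr x y := (pr_ne_suc x y a).symm

omit [IsSetModel S] in
theorem isNat_num (n : ℕ) : S.IsNat (S.num n) := fun X h₀ hs => by
  induction n with
  | zero => exact h₀
  | succ n ih => exact hs _ ih

end Str

/-! ### The meaning of the set-theoretic formulas -/

section

variable {M : Type} [Nonempty M] {S : Str M} [IsSetModel S] {v : ℕ → M}

open Str

@[simp] theorem sat_isEmpty {x : ℕ} : Sat S v (isEmpty x) ↔ v x = S.emp := by
  simp [isEmpty, eq_emp_iff]

@[simp] theorem sat_isUPair {p x y : ℕ} :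
    Sat S v (isUPair p x y) ↔ v p = S.upair (v x) (v y) := by
  have h₁ : p ≠ p + x + y + 1 := by omega
  have h₂ : x ≠ p + x + y + 1 := by omega
  have h₃ : y ≠ p + x + y + 1 := by omega
  simp [isUPair, eq_upair_iff, h₁, h₂, h₃]

@[simp] theorem sat_isSucc {y x : ℕ} : Sat S v (isSucc y x) ↔ v y = S.suc (v x) := by
  have h₁ : y ≠ y + x + 1 := by omega
  have h₂ : x ≠ y + x + 1 := by omega
  simp [isSucc, eq_suc_iff, h₁, h₂]

@[simp] theorem sat_isPair {p x y : ℕ} : Sat S v (isPair p x y) ↔ v p = S.pr (v x) (v y) := by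
  have h₁ : p ≠ p + x + y + 1 := by omega
  have h₂ : x ≠ p + x + y + 1 := by omega
  have h₃ : y ≠ p + x + y + 1 := by omega
  simp [isPair, pr, eq_upair_iff (x := v p), h₁, h₂, h₃]

@[simp] theorem sat_isNat {n : ℕ} : Sat S v (isNat n) ↔ S.IsNat (v n) := by
  simp [isNat, isInductive, IsNat]

@[simp] theorem sat_isNum {n x : ℕ} : Sat S v (isNum n x) ↔ v x = S.num n := by
  induction n generalizing v x with
  | zero => simp [isNum, num]
  | succ n ih => simp [isNum, num, ih]

@[simp] theorem sat_isCode {c : Code} {x : ℕ} : Sat S v (isCode c x) ↔ v x = S.den c := by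
  induction c generalizing v x with
  | num n => simp [isCode, den]
  | pair a b iha ihb => simp [isCode, den, iha, ihb]

@[simp] theorem sat_isTagged {k c a : ℕ} :
    Sat S v (isTagged k c a) ↔ v c = S.pr (S.num k) (v a) := by
  have h₁ : c ≠ c + a + 1 := by omega
  have h₂ : a ≠ c + a + 1 := by omega
  simp [isTagged, h₁, h₂]

@[simp] theorem sat_isTagged2 {k c a b : ℕ} :
    Sat S v (isTagged2 k c a b) ↔ v c = S.pr (S.num k) (S.pr (v a) (v b)) := by
  have h₁ : c ≠ c + a + b + 1 := by omega
  have h₂ : a ≠ c + a + b + 1 := by omega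
  have h₃ : b ≠ c + a + b + 1 := by omega
  simp [isTagged2, h₁, h₂, h₃]

@[simp] theorem sat_isModCode {c i j k : ℕ} : Sat S v (isModCode c i j k) ↔
    v c = S.pr (S.num 3) (S.pr (v i) (S.pr (v j) (v k))) := by
  have h₁ : c ≠ c + i + j + k + 1 := by omega
  have h₂ : i ≠ c + i + j + k + 1 := by omega
  have h₃ : j ≠ c + i + j + k + 1 := by omega
  have h₄ : k ≠ c + i + j + k + 1 := by omega
  simp [isModCode, h₁, h₂, h₃, h₄]

/-- By external induction on φ. Codes of actual formulas thus satisfy `isForm` even if the model has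
nonstandard formulas, and the compositional clauses apply to them. -/
theorem mem_of_isFormClosed {X : ℕ} (h : Sat S v (isFormClosed X)) (φ : Fml) :
    S.mem (S.den φ.code) (v X) := by
  simp only [isFormClosed, isEqCode, isMemCode, isUniCode, isNegCode, isAndCode, isAllCode, sat_and,
    sat_all, sat_imp, sat_isNat, sat_isTagged, sat_isTagged2, sat_isModCode, sat_mem] at h
  simp only [update_apply] at h
  simp at h
  obtain ⟨h₀, h₁, h₂, h₃, h₄, h₅, h₆⟩ := h
  induction φ with
  | eq i j => exact h₀ _ _ _ (isNat_num i) (isNat_num j) rfl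
  | mem i j => exact h₁ _ _ _ (isNat_num i) (isNat_num j) rfl
  | uni i => exact h₂ _ (isNat_num i)
  | mod i j k => exact h₃ _ _ _ _ (isNat_num i) (isNat_num j) (isNat_num k) rfl
  | neg φ ih => exact h₄ _ ih
  | and φ ψ ih₁ ih₂ => exact h₅ _ _ _ ih₁ ih₂ rfl
  | all i φ ih => exact h₆ _ _ _ (isNat_num i) ih rfl

theorem sat_isForm {c : ℕ} {φ : Fml} (h : v c = S.den φ.code) : Sat S v (isForm c) := by
  simp only [isForm, sat_all, sat_imp]
  intro X hX
  simpa [h] using mem_of_isFormClosed hX φ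

@[simp] theorem sat_isVal {f i a : ℕ} :
    Sat S v (isVal f i a) ↔ S.mem (S.pr (v i) (v a)) (v f) := by
  have h₁ : f ≠ f + i + a + 1 := by omega
  have h₂ : i ≠ f + i + a + 1 := by omega
  have h₃ : a ≠ f + i + a + 1 := by omega
  simp [isVal, h₁, h₂, h₃]

@[simp] theorem sat_isAssign {f U : ℕ} :
    Sat S v (isAssign f U) ↔ S.IsAssign (v f) (v U) := by
  have hf : ∀ n, f ≠ f + U + (n + 1) := by omega
  have hU : ∀ n, U ≠ f + U + (n + 1) := by omega
  simp [isAssign, IsAssign, hf 0, hf 1, hf 2, hf 3, hU 0, hU 1, hU 2]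

@[simp] theorem sat_trBox {x : ℕ} : Sat S v (trBox x) ↔ S.Tr (v x) := by
  simp [trBox, Tr]

@[simp] theorem sat_trBoxQuote {σ : Fml} : Sat S v (trBoxQuote σ) ↔ S.Tr (S.den σ.code) := by
  simp [trBoxQuote]

theorem mod_cNeg {U f : M} (h : ∀ v, Sat S v cmNeg) (hU : S.uni U) (hf : S.IsAssign f U)
    (φ : Fml) : S.mod U (S.den φ.neg.code) f ↔ ¬ S.mod U (S.den φ.code) f := by
  have h' := h fun _ => U
  simp only [cmNeg, isNegCode, sat_all, sat_imp, sat_uni, sat_isAssign, sat_isTagged, sat_iff,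
    sat_mod, sat_neg] at h'
  simpa [update_apply] using h' U (by simpa) (S.den φ.code) (sat_isForm rfl) f
    (by simpa [update_apply]) (S.den φ.neg.code) (by simp; rfl)

theorem mod_cAnd {U f : M} (h : ∀ v, Sat S v cmAnd) (hU : S.uni U) (hf : S.IsAssign f U)
    (φ ψ : Fml) : S.mod U (S.den (φ.and ψ).code) f ↔
      S.mod U (S.den φ.code) f ∧ S.mod U (S.den ψ.code) f := by
  have h' := h fun _ => U
  simp only [cmAnd, isAndCode, sat_all, sat_imp, sat_uni, sat_isAssign, sat_isTagged2, sat_iff,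
    sat_mod, sat_and] at h'
  simpa [update_apply] using h' U (by simpa) (S.den φ.code) (S.den ψ.code)
    ⟨sat_isForm (by simp; rfl), sat_isForm (by simp; rfl)⟩ f
    (by simpa [update_apply]) (S.den (φ.and ψ).code) (by simp; rfl)

/-- The constant assignments. -/
theorem exists_isAssign (h : ∀ ψ ∈ zfUniMod, ∀ v, Sat S v ψ) {U a : M} (ha : S.mem a U) :
    ∃ f, S.IsAssign f U := by
  obtain ⟨X, hX⟩ : ∃ X, ∀ n, S.IsNat n → S.mem n X := by
    have := h _ (Or.inl (Or.inl (Or.inr (Or.inr (Or.inr (Or.inr (Or.inr rfl))))))) fun _ => a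
    simp only [isInductive, sat_all, sat_ex, sat_and, sat_imp, sat_mem, sat_isEmpty,
      sat_isSucc] at this
    simp only [update_apply] at this
    simp at this
    obtain ⟨X, h₀, hs⟩ := this
    exact ⟨X, fun n hn => hn X h₀ hs⟩
  -- Replacement along n ↦ ⟨n, a⟩, with a as the value of the parameter x₅. The inductive set X may
  -- have further elements, which the conjunct `isNat 0` discards.
  have hr := h _ (Or.inr ⟨isNat 0 ∧ₒ isPair 1 0 5, 0, 1, 2, 3, 4, by decide, by decide, by decide,
    rfl⟩) fun _ => a
  simp only [sat_all, sat_ex, sat_iff, sat_and, sat_imp, sat_mem, sat_eq, sat_isNat,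
    sat_isPair] at hr
  simp only [update_apply] at hr
  simp at hr
  obtain ⟨f, hf⟩ := hr X fun x _ => ⟨S.pr x a, fun _ => rfl⟩
  refine ⟨f, fun p hp => ?_, fun i hi => ⟨a, (hf _).2 ⟨i, hX i hi, hi, rfl⟩, fun b hb => ?_⟩⟩
  · obtain ⟨i, -, hi, e⟩ := (hf p).1 hp
    exact ⟨i, a, hi, ha, e⟩
  · obtain ⟨j, -, -, e⟩ := (hf _).1 hb
    exact (pr_inj.1 e).2

end

/-! ### Terms for hereditarily finite sets -/

/-- Terms built from variables by `∅`, successor and ordered pairs. -/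
inductive Tm : Type
  | var (i : ℕ) : Tm
  | emp : Tm
  | suc (t : Tm) : Tm
  | pr (a b : Tm) : Tm

namespace Tm

/-- A strict upper bound for the variables of a term. -/
def bound : Tm → ℕ
  | var i => i + 1
  | emp => 0
  | suc t => t.bound
  | pr a b => max a.bound b.bound

/-- The numeral as a term. -/
def num : ℕ → Tm
  | 0 => emp
  | n + 1 => suc (num n)

/-- A code as a term. -/
def ofCode : Code → Tm
  | .num n => num n
  | .pair a b => pr (ofCode a) (ofCode b)

/-- The code of a negation. -/
def cNeg (a : Tm) : Tm := pr (num 4) a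

/-- The code of a conjunction. -/
def cAnd (a b : Tm) : Tm := pr (num 5) (pr a b)

/-- The code of an existential quantification. -/
def cEx (i : ℕ) (a : Tm) : Tm := cNeg (pr (num 6) (pr (num i) (cNeg a)))

@[simp] theorem bound_num (n : ℕ) : (num n).bound = 0 := by
  induction n with
  | zero => rfl
  | succ n ih => exact ih

@[simp] theorem bound_ofCode (c : Code) : (ofCode c).bound = 0 := by
  induction c with
  | num n => exact bound_num n
  | pair a b iha ihb => simp [ofCode, bound, iha, ihb]

/-- The formula `xᵢ = t`, with bound variables from `k` on. -/
def isTm : ℕ → Tm → ℕ → Fml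
  | _, var j, i => i =ₒ j
  | _, emp, i => isEmpty i
  | k, suc t, i => ∃ₒ k (isTm (k + 1) t k ∧ₒ isSucc i k)
  | k, pr a b, i =>
      ∃ₒ k (∃ₒ (k + 1) (isTm (k + 2) a k ∧ₒ isTm (k + 2) b (k + 1) ∧ₒ isPair i k (k + 1)))

variable {M : Type} [Nonempty M] (S : Str M)

/-- The value of a term. -/
noncomputable def eval (v : ℕ → M) : Tm → M
  | var i => v i
  | emp => S.emp
  | suc t => S.suc (eval v t)
  | pr a b => S.pr (eval v a) (eval v b)

variable {S} {v : ℕ → M}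

@[simp] theorem eval_num (n : ℕ) : (num n).eval S v = S.num n := by
  induction n with
  | zero => rfl
  | succ n ih => simp [num, eval, ih, Str.num]

@[simp] theorem eval_ofCode (c : Code) : (ofCode c).eval S v = S.den c := by
  induction c with
  | num n => exact eval_num n
  | pair a b iha ihb => simp [ofCode, eval, iha, ihb, Str.den]

theorem eval_update {t : Tm} {k : ℕ} (h : t.bound ≤ k) (a : M) :
    t.eval S (update v k a) = t.eval S v := by
  induction t with
  | var i => simp only [bound] at h; simp [eval, show i ≠ k by omega]
  | emp => rfl
  | suc t ih => simp [eval, ih h]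
  | pr a b iha ihb =>
    simp only [bound, max_le_iff] at h
    simp [eval, iha h.1, ihb h.2]

theorem sat_isTm [IsSetModel S] {t : Tm} {k i : ℕ} (h : t.bound ≤ k) (hi : i < k) :
    Sat S v (isTm k t i) ↔ v i = t.eval S v := by
  induction t generalizing v k i with
  | var j => rfl
  | emp => simp [isTm, eval]
  | suc t ih =>
    have : i ≠ k := hi.ne
    change t.bound ≤ k at h
    simp [isTm, eval, ih (show t.bound ≤ k + 1 by omega), eval_update h, this]
  | pr a b iha ihb =>
    simp only [bound, max_le_iff] at h
    have h₁ : i ≠ k := hi.ne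
    have h₂ : i ≠ k + 1 := by omega
    simp [isTm, eval, iha (show a.bound ≤ k + 2 by omega), ihb (show b.bound ≤ k + 2 by omega),
      eval_update h.1, eval_update h.2, eval_update (show a.bound ≤ k + 1 by omega),
      eval_update (show b.bound ≤ k + 1 by omega), h₁, h₂]

end Tm

/-! ### Names of codes -/

/-- `∃x₀ (x₀ = xᵢ ∧ φ)`. -/
def Fml.at (i : ℕ) (φ : Fml) : Fml := ∃ₒ 0 (0 =ₒ i ∧ₒ φ)

/-- A formula that defines the numeral `n`, with `x₀` as its only free variable. -/
def nameNum : ℕ → Fml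
  | 0 => isEmpty 0
  | n + 1 => ∃ₒ 1 (Fml.at 1 (nameNum n) ∧ₒ isSucc 0 1)

/-- A formula that defines the set denoted by a code, with `x₀` as its only free variable.
The code of this formula is a simple recursive function of the given code. -/
def name : Code → Fml
  | .num n => nameNum n
  | .pair a b =>
      ∃ₒ 1 (∃ₒ 2 (Fml.at 1 (name a) ∧ₒ Fml.at 2 (name b) ∧ₒ isPair 0 1 2))

/-- The recursion step for successors in the computation of the code of `name c`. -/
def Tm.nameSuc (y : Tm) : Tm :=
  cEx 1 (cAnd (cEx 0 (cAnd (ofCode (0 =ₒ 1).code) y)) (ofCode (isSucc 0 1).code))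

/-- The recursion step for pairs in the computation of the code of `name c`. -/
def Tm.namePair (y z : Tm) : Tm :=
  cEx 1 (cEx 2 (cAnd (cEx 0 (cAnd (ofCode (0 =ₒ 1).code) y))
    (cAnd (cEx 0 (cAnd (ofCode (0 =ₒ 2).code) z)) (ofCode (isPair 0 1 2).code))))

/-- `t ∈ x₃`, for terms `t` in variables below `x₁₁`. -/
def termMem (t : Tm) : Fml := ∃ₒ 9 (Tm.isTm 11 t 9 ∧ₒ 9 ∈ₒ 3)

/-- Every element of `x₃` is a pair `⟨c, y⟩` that is obtained by one recursion step from pairs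
in `x₃`. -/
def isComputation : Fml :=
  ∀ₒ 4 (4 ∈ₒ 3 →ₒ
    (Tm.isTm 11 (.pr .emp (.ofCode (isEmpty 0).code)) 4 ∨ₒ
    (∃ₒ 5 (∃ₒ 6 (termMem (.pr (.var 5) (.var 6)) ∧ₒ
      Tm.isTm 11 (.pr (.suc (.var 5)) (.nameSuc (.var 6))) 4))) ∨ₒ
    (∃ₒ 5 (∃ₒ 6 (∃ₒ 7 (∃ₒ 8 (termMem (.pr (.var 5) (.var 6)) ∧ₒ
      termMem (.pr (.var 7) (.var 8)) ∧ₒ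
      Tm.isTm 11 (.pr (.pr (.var 5) (.var 7)) (.namePair (.var 6) (.var 8))) 4)))))))

/-- `x₁` is the code of `name c` for the code `c = x₀`. -/
def isNameCode : Fml := ∃ₒ 3 (isComputation ∧ₒ termMem (.pr (.var 0) (.var 1)))

/-! ### Computing the code of `name c` inside a structure -/

namespace Str

variable {M : Type} [Nonempty M] (S : Str M)

/-- The recursion step for successors in the computation of the code of `name c`. -/
noncomputable def nameSuc (y : M) : M :=
  S.cEx 1 (S.cAnd (S.cEx 0 (S.cAnd (S.den (0 =ₒ 1).code) y)) (S.den (isSucc 0 1).code))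

/-- The recursion step for pairs in the computation of the code of `name c`. -/
noncomputable def namePair (y z : M) : M :=
  S.cEx 1 (S.cEx 2 (S.cAnd (S.cEx 0 (S.cAnd (S.den (0 =ₒ 1).code) y))
    (S.cAnd (S.cEx 0 (S.cAnd (S.den (0 =ₒ 2).code) z)) (S.den (isPair 0 1 2).code))))

/-- Every element of `X` is a pair `⟨c, y⟩` that is obtained by one recursion step from pairs
in `X`. -/
def IsComputation (X : M) : Prop :=
  ∀ p, S.mem p X → p = S.pr S.emp (S.den (isEmpty 0).code) ∨
    (∃ c y, S.mem (S.pr c y) X ∧ p = S.pr (S.suc c) (S.nameSuc y)) ∨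
    ∃ c y d z, S.mem (S.pr c y) X ∧ S.mem (S.pr d z) X ∧ p = S.pr (S.pr c d) (S.namePair y z)

variable {S} [IsSetModel S]

theorem IsComputation.union {X Y : M} (hX : S.IsComputation X) (hY : S.IsComputation Y) :
    S.IsComputation (S.union X Y) := by
  intro p hp
  simp only [mem_union] at hp ⊢
  rcases hp with hp | hp
  · rcases hX p hp with h | ⟨c, y, h, e⟩ | ⟨c, y, d, z, h, h', e⟩
    · exact Or.inl h
    · exact Or.inr (Or.inl ⟨c, y, Or.inl h, e⟩)
    · exact Or.inr (Or.inr ⟨c, y, d, z, Or.inl h, Or.inl h', e⟩)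
  · rcases hY p hp with h | ⟨c, y, h, e⟩ | ⟨c, y, d, z, h, h', e⟩
    · exact Or.inl h
    · exact Or.inr (Or.inl ⟨c, y, Or.inr h, e⟩)
    · exact Or.inr (Or.inr ⟨c, y, d, z, Or.inr h, Or.inr h', e⟩)

theorem IsComputation.insert {X q : M} (hX : S.IsComputation X)
    (hq : q = S.pr S.emp (S.den (isEmpty 0).code) ∨
      (∃ c y, S.mem (S.pr c y) X ∧ q = S.pr (S.suc c) (S.nameSuc y)) ∨
      ∃ c y d z, S.mem (S.pr c y) X ∧ S.mem (S.pr d z) X ∧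
        q = S.pr (S.pr c d) (S.namePair y z)) :
    S.IsComputation (S.union X (S.upair q q)) := by
  intro p hp
  simp only [mem_union, mem_upair, or_self] at hp ⊢
  have : p = S.pr S.emp (S.den (isEmpty 0).code) ∨
      (∃ c y, S.mem (S.pr c y) X ∧ p = S.pr (S.suc c) (S.nameSuc y)) ∨
      ∃ c y d z, S.mem (S.pr c y) X ∧ S.mem (S.pr d z) X ∧
        p = S.pr (S.pr c d) (S.namePair y z) := by
    rcases hp with hp | rfl
    · exact hX p hp
    · exact hq
  rcases this with h | ⟨c, y, h, e⟩ | ⟨c, y, d, z, h, h', e⟩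
  · exact Or.inl h
  · exact Or.inr (Or.inl ⟨c, y, Or.inl h, e⟩)
  · exact Or.inr (Or.inr ⟨c, y, d, z, Or.inl h, Or.inl h', e⟩)

/-- Computations are closed under unions and under adding one justified pair, so one is built along
c. -/
theorem exists_isComputation (c : Code) :
    ∃ X, S.IsComputation X ∧ S.mem (S.pr (S.den c) (S.den (name c).code)) X := by
  induction c with
  | num n =>
    induction n with
    | zero =>
      have h₀ : S.IsComputation S.emp := fun p hp => (not_mem_emp p hp).elim
      exact ⟨_, h₀.insert (Or.inl rfl), by simp; right; exact ⟨rfl, rfl⟩⟩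
    | succ n ih =>
      obtain ⟨X, hX, hm⟩ := ih
      exact ⟨_, hX.insert (Or.inr (Or.inl ⟨_, _, hm, rfl⟩)), by simp; right; exact ⟨rfl, rfl⟩⟩
  | pair a b iha ihb =>
    obtain ⟨X, hX, hm⟩ := iha
    obtain ⟨Y, hY, hn⟩ := ihb
    exact ⟨_, (hX.union hY).insert (Or.inr (Or.inr ⟨_, _, _, _, mem_union.2 (Or.inl hm),
      mem_union.2 (Or.inr hn), rfl⟩)), by simp; right; exact ⟨rfl, rfl⟩⟩

/-- The empty set, successors and pairs are mutually distinct and the operations injective, so the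
first component determines which recursion step was used and on which arguments. External induction
on c suffices; nothing is claimed about nonstandard entries of X. -/
theorem IsComputation.eq_den {X : M} (hX : S.IsComputation X) (c : Code) {y : M}
    (h : S.mem (S.pr (S.den c) y) X) : y = S.den (name c).code := by
  induction c generalizing y with
  | num n =>
    induction n generalizing y with
    | zero =>
      rcases hX _ h with h | ⟨c, z, -, e⟩ | ⟨c, z, d, w, -, -, e⟩
      · exact (pr_inj.1 h).2
      · exact absurd (pr_inj.1 e).1 (emp_ne_suc _)
      · exact absurd (pr_inj.1 e).1 (emp_ne_pr _ _)
    | succ n ih =>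
      rcases hX _ h with h | ⟨c, z, hm, e⟩ | ⟨c, z, d, w, -, -, e⟩
      · exact absurd (pr_inj.1 h).1 (suc_ne_emp _)
      · obtain ⟨h₁, rfl⟩ := pr_inj.1 e
        rw [← suc_inj.1 h₁] at hm
        rw [ih hm]
        rfl
      · exact absurd (pr_inj.1 e).1 (suc_ne_pr _ _ _)
  | pair a b iha ihb =>
    rcases hX _ h with h | ⟨c, z, hm, e⟩ | ⟨c, z, d, w, hm, hn, e⟩
    · exact absurd (pr_inj.1 h).1 (pr_ne_emp _ _)
    · exact absurd (pr_inj.1 e).1 (pr_ne_suc _ _ _)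
    · obtain ⟨h₁, rfl⟩ := pr_inj.1 e
      obtain ⟨rfl, rfl⟩ := pr_inj.1 h₁
      rw [iha hm, ihb hn]
      rfl

end Str

/-! ### Semantics and free variables of the naming formulas -/

section

variable {M : Type} [Nonempty M] {S : Str M} [IsSetModel S] {v : ℕ → M}

open Str

omit [Nonempty M] [IsSetModel S] in
@[simp] theorem sat_at {i : ℕ} (hi : i ≠ 0) {φ : Fml} :
    Sat S v (φ.at i) ↔ Sat S (update v 0 (v i)) φ := by
  simp [Fml.at, hi]

@[simp] theorem sat_name {c : Code} : Sat S v (name c) ↔ v 0 = S.den c := by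
  induction c generalizing v with
  | num n =>
    rw [name, den]
    induction n generalizing v with
    | zero => simp [nameNum, num]
    | succ n ih => simp [nameNum, num, ih]
  | pair a b iha ihb => simp [name, den, iha, ihb]

theorem fv_isPair (p x y : ℕ) : (isPair p x y).fv ⊆ {p, x, y} := by
  intro i
  simp only [isPair, isUPair, Fml.iff, Fml.imp, Fml.or, Fml.fv, Finset.mem_erase, Finset.mem_union,
    Finset.mem_insert, Finset.mem_singleton]
  omega

theorem fv_isSucc (y x : ℕ) : (isSucc y x).fv ⊆ {y, x} := by
  intro i
  simp only [isSucc, Fml.iff, Fml.imp, Fml.or, Fml.fv, Finset.mem_erase, Finset.mem_union,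
    Finset.mem_insert, Finset.mem_singleton]
  omega

theorem fv_isNum (n x : ℕ) : (isNum n x).fv ⊆ {x} := by
  induction n generalizing x with
  | zero => intro i; simp [isNum, isEmpty, Fml.fv]
  | succ n ih =>
    intro i
    have h₁ := @ih (x + 1) i
    have h₂ := @fv_isSucc x (x + 1) i
    simp only [isNum, Fml.ex, Fml.fv, Finset.mem_erase, Finset.mem_union, Finset.mem_insert,
      Finset.mem_singleton] at h₁ h₂ ⊢
    tauto

theorem fv_isCode (c : Code) (x : ℕ) : (isCode c x).fv ⊆ {x} := by
  induction c generalizing x with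
  | num n => exact fv_isNum n x
  | pair a b iha ihb =>
    intro i
    have h₁ := @iha (x + 1) i
    have h₂ := @ihb (x + 2) i
    have h₃ := @fv_isPair x (x + 1) (x + 2) i
    simp only [isCode, Fml.ex, Fml.fv, Finset.mem_erase, Finset.mem_union, Finset.mem_insert,
      Finset.mem_singleton] at h₁ h₂ h₃ ⊢
    tauto

theorem isSentence_trBoxQuote (σ : Fml) : (trBoxQuote σ).IsSentence := by
  have h : (trBox 0).fv ⊆ {0} := by decide
  have h' := fv_isCode σ.code 0
  change ((isCode σ.code 0).fv ∪ (trBox 0).fv).erase 0 = ∅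
  rw [← Finset.subset_empty, ← Finset.subset_insert_iff]
  exact Finset.union_subset h' h

theorem fv_name (c : Code) : (name c).fv ⊆ {0} := by
  induction c with
  | num n =>
    rw [name]
    induction n with
    | zero => decide
    | succ n ih =>
      intro i
      have h₁ := @ih i
      have h₂ := @fv_isSucc 0 1 i
      simp only [nameNum, Fml.at, Fml.ex, Fml.fv, Finset.mem_erase, Finset.mem_union,
        Finset.mem_insert, Finset.mem_singleton] at h₁ h₂ ⊢
      tauto
  | pair a b iha ihb =>
    intro i
    have h₁ := @iha i
    have h₂ := @ihb i
    have h₃ := @fv_isPair 0 1 2 i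
    simp only [name, Fml.at, Fml.ex, Fml.fv, Finset.mem_erase, Finset.mem_union, Finset.mem_insert,
      Finset.mem_singleton] at h₁ h₂ h₃ ⊢
    tauto

@[simp] theorem sat_termMem {t : Tm} (h : t.bound ≤ 9) :
    Sat S v (termMem t) ↔ S.mem (t.eval S v) (v 3) := by
  simp [termMem, Tm.sat_isTm (show t.bound ≤ 11 by omega), Tm.eval_update h]

theorem sat_isComputation : Sat S v isComputation ↔ S.IsComputation (v 3) := by
  simp [isComputation, IsComputation, Tm.sat_isTm, Tm.bound, Tm.nameSuc, Tm.namePair, Tm.cNeg,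
    Tm.cAnd, Tm.cEx, Tm.eval, nameSuc, namePair, cNeg, cAnd, cEx]

theorem sat_isNameCode : Sat S v isNameCode ↔
    ∃ X, S.IsComputation X ∧ S.mem (S.pr (v 0) (v 1)) X := by
  simp [isNameCode, sat_isComputation, Tm.bound, Tm.eval]

end

/-! ### The liar -/

/-- The formula "the diagonalization of `x₀` is not true in all universes", up to quantification
over unused variables. -/
def liarBody : Fml :=
  ∃ₒ 1 (∃ₒ 2 (isNameCode ∧ₒ Tm.isTm 3 (.cEx 0 (.cAnd (.var 1) (.var 0))) 2 ∧ₒ ¬ₒ trBox 2))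

/-- The formula "the diagonalization of `x₀` is not true in all universes". -/
noncomputable def liarFml : Fml := liarBody.close (liarBody.fv.erase 0).toList

/-- A sentence that says of itself that it is not true in all universes. -/
noncomputable def liar : Fml := ∃ₒ 0 (name liarFml.code ∧ₒ liarFml)

theorem Fml.mem_fv_close {φ : Fml} {l : List ℕ} {i : ℕ} :
    i ∈ (φ.close l).fv ↔ i ∈ φ.fv ∧ i ∉ l := by
  induction l with
  | nil => simp [Fml.close]
  | cons j l ih =>
    change i ∈ ((φ.close l).fv.erase j) ↔ _
    rw [Finset.mem_erase, ih, List.mem_cons]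
    tauto

theorem Fml.fv_close_erase (φ : Fml) (i : ℕ) : (φ.close (φ.fv.erase i).toList).fv ⊆ {i} := by
  intro j hj
  rw [mem_fv_close, Finset.mem_toList, Finset.mem_erase] at hj
  rw [Finset.mem_singleton]
  tauto

theorem fv_liarFml : liarFml.fv ⊆ {0} := liarBody.fv_close_erase 0

theorem isSentence_liar : liar.IsSentence := by
  change ((name liarFml.code).fv ∪ liarFml.fv).erase 0 = ∅
  rw [← Finset.subset_empty, ← Finset.subset_insert_iff]
  exact Finset.union_subset (fv_name _) fv_liarFml

/-- Quantifying over variables on which truth does not depend changes nothing. This spares a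
computation of the free variables of `liarBody`. -/
theorem sat_close {M : Type} {S : Str M} {φ : Fml} {l : List ℕ} {v : ℕ → M} {Q : M → Prop}
    [Nonempty M] (hφ : ∀ v : ℕ → M, Sat S v φ ↔ Q (v 0)) (hl : 0 ∉ l) :
    Sat S v (φ.close l) ↔ Q (v 0) := by
  induction l generalizing v with
  | nil => exact hφ v
  | cons i l ih =>
    simp only [List.mem_cons, not_or] at hl
    change (∀ a, Sat S (update v i a) (φ.close l)) ↔ _
    simp [ih hl.2, hl.1]

theorem sat_liarFml {M : Type} [Nonempty M] {S : Str M} [IsSetModel S] {v : ℕ → M} {c : Code}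
    (h : v 0 = S.den c) :
    Sat S v liarFml ↔ ¬ S.Tr (S.cEx 0 (S.cAnd (S.den (name c).code) (S.den c))) := by
  rw [liarFml, sat_close (Q := fun x => ∃ y, (∃ X, S.IsComputation X ∧ S.mem (S.pr x y) X) ∧
    ¬ S.Tr (S.cEx 0 (S.cAnd y x))) _ (by simp), h]
  · constructor
    · rintro ⟨y, ⟨X, hX, hm⟩, ht⟩
      rwa [← hX.eq_den c hm]
    · exact fun ht => ⟨_, Str.exists_isComputation c, ht⟩
  · intro v
    simp [liarBody, sat_isNameCode, Tm.sat_isTm, Tm.bound, Tm.eval, Tm.cNeg, Tm.cAnd, Tm.cEx,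
      Str.cNeg, Str.cAnd, Str.cEx]

/-- The fixed-point property: `liar` is the diagonalization of `liarFml`, and its code unfolds
definitionally to the set that `liarFml` speaks of at its own code. -/
theorem sat_liar {M : Type} [Nonempty M] {S : Str M} [IsSetModel S] {v : ℕ → M} :
    Sat S v liar ↔ ¬ S.Tr (S.den liar.code) := by
  have h : S.den liar.code =
    S.cEx 0 (S.cAnd (S.den (name liarFml.code).code) (S.den liarFml.code)) := rfl
  rw [h, liar, sat_ex]
  constructor
  · rintro ⟨a, ha⟩
    rw [sat_and, sat_name, update_self] at ha
    exact (sat_liarFml (by simpa using ha.1)).1 ha.2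
  · intro ht
    refine ⟨S.den liarFml.code, ?_⟩
    rw [sat_and, sat_name, update_self]
    exact ⟨rfl, (sat_liarFml (by simp)).2 ht⟩

/-! ### The two inconsistencies -/

/-- Completeness in the form used below: the models satisfy everything derivable with NEC, and set
theory can be done in them. -/
theorem NecProvable.of_zf_models {A : Set Fml} (hA : cmMinus ⊆ A) {φ : Fml}
    (h : ∀ (M : Type) (S : Str M) (_ : Nonempty M) (_ : IsSetModel S),
      (∀ ψ, NecProvable A ψ → ∀ v, Sat S v ψ) → ∀ v, Sat S v φ) : NecProvable A φ :=
  .of_models fun M S hM hS => h M S hM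
    (isSetModel_of_zf fun ψ hψ => hS ψ (.ax (hA (Or.inl hψ)))) hS

theorem necInconsistent_of_not_trBoxQuote_liar {A : Set Fml} (hA : cmMinus ⊆ A)
    (h : NecProvable A (¬ₒ trBoxQuote liar)) : NecInconsistent A := by
  have hl : NecProvable A liar := .of_zf_models hA fun M S _ _ hS v => by
    have := hS _ h v
    rwa [sat_neg, sat_trBoxQuote, ← sat_liar] at this
  exact ⟨_, .nec isSentence_liar hl, h⟩

theorem necInconsistent_schemaT {A : Set Fml} (hA : cmMinus ⊆ A) (hT : schemaT ⊆ A) :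
    NecInconsistent A :=
  necInconsistent_of_not_trBoxQuote_liar hA <| .of_zf_models hA fun M S _ _ hS v => by
    have := hS _ (.ax (hT ⟨liar, isSentence_liar, rfl⟩)) v
    rw [sat_imp, sat_trBoxQuote, sat_liar] at this
    rw [sat_neg, sat_trBoxQuote]
    tauto

theorem necInconsistent_schema4 {A : Set Fml} (hA : cmMinus ⊆ A) (h4 : schema4 ⊆ A)
    (hne : universesNonempty ∈ A) (hnt : nonTriviality ∈ A) : NecInconsistent A := by
  -- NEC carries one direction of the fixed point into every universe.
  have h₁ : NecProvable A (trBoxQuote (liar →ₒ ¬ₒ trBoxQuote liar)) := by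
    refine .nec ?_ (.of_zf_models hA fun M S _ _ hS v => ?_)
    · change liar.fv ∪ (trBoxQuote liar).fv = ∅
      rw [isSentence_liar, isSentence_trBoxQuote]
      rfl
    · rw [sat_imp, sat_neg, sat_trBoxQuote, sat_liar]
      exact id
  refine necInconsistent_of_not_trBoxQuote_liar hA (.of_zf_models hA fun M S _ _ hS v => ?_)
  have hcm : ∀ ψ ∈ cmMinus, ∀ v, Sat S v ψ := fun ψ hψ => hS ψ (.ax (hA hψ))
  have hneg := hcm cmNeg (Or.inr (Or.inr (Or.inl rfl)))
  have hand := hcm cmAnd (Or.inr (Or.inr (Or.inr (Or.inl rfl))))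
  obtain ⟨U, hU⟩ : ∃ U, S.uni U := by simpa [nonTriviality] using hS _ (.ax hnt) v
  obtain ⟨a, ha⟩ : ∃ a, S.mem a U := by
    have := hS _ (.ax hne) v
    simp only [universesNonempty, sat_all, sat_imp, sat_ex, sat_uni, sat_mem] at this
    simpa [update_apply] using this U (by simpa)
  obtain ⟨f, hf⟩ := exists_isAssign (fun ψ hψ => hcm ψ (Or.inl hψ)) ha
  have h₂ := hS _ (.ax (h4 ⟨liar, isSentence_liar, rfl⟩)) v
  have h₃ := hS _ h₁ v
  rw [sat_imp, sat_trBoxQuote, sat_trBoxQuote] at h₂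
  rw [sat_trBoxQuote] at h₃
  rw [sat_neg, sat_trBoxQuote]
  intro ht
  have h₄ := h₃ U hU f hf
  -- The implication abbreviates ¬(λ ∧ ¬¬Tr(⌜λ⌝)), so the clauses for ¬ and ∧ evaluate it in U; `ht`
  -- and schema 4 make both conjuncts true there.
  rw [Fml.imp, mod_cNeg hneg hU hf, mod_cAnd hand hU hf, mod_cNeg hneg hU hf,
    mod_cNeg hneg hU hf] at h₄
  exact h₄ ⟨ht U hU f hf, fun h => h (h₂ ht U hU f hf)⟩

end Multiverse

theorem mainTheorem8 :
    Multiverse.NecInconsistent (Multiverse.cmMinus ∪ Multiverse.schemaT) ∧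
    Multiverse.NecInconsistent
      (Multiverse.cmMinus ∪ {Multiverse.universesNonempty, Multiverse.nonTriviality} ∪
        Multiverse.schema4) :=
  ⟨Multiverse.necInconsistent_schemaT Set.subset_union_left Set.subset_union_right,
    Multiverse.necInconsistent_schema4
      (Set.subset_union_left.trans Set.subset_union_left) Set.subset_union_right
      (Or.inl (Or.inr (Or.inl rfl))) (Or.inl (Or.inr (Or.inr rfl)))⟩
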